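/- Let $(M,\omega)$ be a complex Hermitian manifold (finite-dimensional, Hausdorff, second countable), and let $U\Subset M$ be a relatively compact open set with smooth boundary: $U=\{z\in U_1 : r(z)<0\}$, where $U_1$ is an open neighborhood of $\overline U$, $r:U_1\to\mathbb{R}$ is of class $\mathcal C^\infty$, and $dr\neq 0$ at every point of $\partial U$. ($U$ need not be connected.) Assume that $U$ is pseudoconvex: at every $z\in\partial U$, the Levi form of $r$ is nonnegative on every $(1,0)$-tangent vector $t$ with $\langle\partial r(z),t\rangle=0$, i.e. $\sum_{j,k}\frac{\partial^2 r}{\partial z_j\partial\bar z_k}(z)\,t_j\bar t_k\ge 0$ in local coordinates. A *Levi current* on $\partial U$ is a positive current $T$ of bidimension $(1,1)$ on $M$, supported on $\partial U$, such that $$T\wedge\partial r=0,\qquad T\wedge\partial\overline\partial r=0,\qquad i\partial\overline\partial T=0,\qquad \langle T,\omega\rangle=1.$$ Then there is no Levi current on $\partial U$ if and only if there is a $\mathcal C^\infty$ strictly plurisubharmonic function $u$ (that is, $i\partial\overline\partial u$ is positive definite) on some open neighborhood of $\partial U$. -/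

import Mathlib

open scoped Manifold ContDiff Topology ComplexOrder
open Set Filter

noncomputable section

namespace LeviCurrent

section LocalCalculus

variable {E : Type*} [NormedAddCommGroup E] [NormedSpace ℂ E]

/-- The `(1,0)`-part of the real differential of `f` at `z`, as a complex linear functional:
`∂f(t) = ∑ⱼ (∂f/∂zⱼ) tⱼ = (1/2) (Df(t) - i Df(it))`. -/
def delAt (f : E → ℂ) (z : E) : E →ₗ[ℂ] ℂ where
  toFun t := (1 / 2 : ℂ) * (fderiv ℝ f z t - Complex.I * fderiv ℝ f z (Complex.I • t))
  map_add' t t' := by simp only [smul_add, map_add]; ring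
  map_smul' c t := by
    obtain ⟨a, b⟩ := c
    have h1 : (⟨a, b⟩ : ℂ) = (a : ℂ) + (b : ℂ) * Complex.I := Complex.mk_eq_add_mul_I a b
    have h2 : ((a : ℂ) + (b : ℂ) * Complex.I) • t = a • t + b • (Complex.I • t) := by
      rw [add_smul, mul_smul]; rfl
    have h3 : Complex.I • (a • t + b • (Complex.I • t)) = a • (Complex.I • t) - b • t := by
      rw [smul_add, smul_comm Complex.I a t, smul_comm Complex.I b, smul_smul Complex.I Complex.I,
        Complex.I_mul_I, neg_one_smul, smul_neg, sub_eq_add_neg]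
    simp only [h1, h2, h3, map_add, map_sub, map_smul, Complex.real_smul, RingHom.id_apply,
      smul_eq_mul]
    linear_combination ((1 / 2 : ℂ) * b * fderiv ℝ f z (Complex.I • t)) * Complex.I_sq

/-- The complex Hessian (Levi form) of `f` at `z`, as a sesquilinear form:
`(t, s) ↦ ∑ⱼₖ (∂²f/∂zⱼ∂z̄ₖ) tⱼ s̄ₖ`, written with the second real derivative `D²f` as
`(1/4) (D²f(t,s) + D²f(it,is) + i (D²f(t,is) - D²f(it,s)))`. -/
def leviAt (f : E → ℂ) (z : E) : E →ₗ[ℂ] E →ₗ⋆[ℂ] ℂ :=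
  LinearMap.mk₂'ₛₗ (RingHom.id ℂ) (starRingEnd ℂ)
    (fun t s => (1 / 4 : ℂ) * (fderiv ℝ (fderiv ℝ f) z t s
      + fderiv ℝ (fderiv ℝ f) z (Complex.I • t) (Complex.I • s)
      + Complex.I * (fderiv ℝ (fderiv ℝ f) z t (Complex.I • s)
        - fderiv ℝ (fderiv ℝ f) z (Complex.I • t) s)))
    (by intro t t' s; simp only [smul_add, map_add, add_apply]; ring)
    (by
      rintro ⟨a, b⟩ t s
      have h1 : (⟨a, b⟩ : ℂ) = (a : ℂ) + (b : ℂ) * Complex.I := Complex.mk_eq_add_mul_I a b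
      have h2 : ((a : ℂ) + (b : ℂ) * Complex.I) • t = a • t + b • (Complex.I • t) := by
        rw [add_smul, mul_smul]; rfl
      have h3 : Complex.I • (a • t + b • (Complex.I • t)) = a • (Complex.I • t) - b • t := by
        rw [smul_add, smul_comm Complex.I a t, smul_comm Complex.I b,
          smul_smul Complex.I Complex.I, Complex.I_mul_I, neg_one_smul, smul_neg, sub_eq_add_neg]
      simp only [h1, h2, h3, map_add, map_sub, map_smul, Complex.real_smul, RingHom.id_apply,
        smul_eq_mul, add_apply, sub_apply,
        smul_apply]
      linear_combination (-(1 / 4 : ℂ) * b * (fderiv ℝ (fderiv ℝ f) z t (Complex.I • s)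
        - fderiv ℝ (fderiv ℝ f) z (Complex.I • t) s)) * Complex.I_sq)
    (by intro t s s'; simp only [smul_add, map_add]; ring)
    (by
      rintro ⟨a, b⟩ t s
      have h1 : (⟨a, b⟩ : ℂ) = (a : ℂ) + (b : ℂ) * Complex.I := Complex.mk_eq_add_mul_I a b
      have h2 : ((a : ℂ) + (b : ℂ) * Complex.I) • s = a • s + b • (Complex.I • s) := by
        rw [add_smul, mul_smul]; rfl
      have h3 : Complex.I • (a • s + b • (Complex.I • s)) = a • (Complex.I • s) - b • s := by
        rw [smul_add, smul_comm Complex.I a s, smul_comm Complex.I b,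
          smul_smul Complex.I Complex.I, Complex.I_mul_I, neg_one_smul, smul_neg, sub_eq_add_neg]
      simp only [h1, h2, h3, map_add, map_sub, map_mul, map_smul, Complex.real_smul,
        smul_eq_mul, Complex.conj_ofReal, Complex.conj_I]
      linear_combination ((1 / 4 : ℂ) * b * (fderiv ℝ (fderiv ℝ f) z t (Complex.I • s)
        - fderiv ℝ (fderiv ℝ f) z (Complex.I • t) s)) * Complex.I_sq)

/-- Chain rule for `∂`: it commutes with pull-back by a holomorphic map. -/
theorem delAt_comp {f : E → ℂ} {τ : E → E} {z : E} (hf : DifferentiableAt ℝ f (τ z))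
    (hτ : DifferentiableAt ℂ τ z) (t : E) :
    delAt (f ∘ τ) z t = delAt f (τ z) (fderiv ℂ τ z t) := by
  have h : fderiv ℝ (f ∘ τ) z = (fderiv ℝ f (τ z)).comp ((fderiv ℂ τ z).restrictScalars ℝ) := by
    rw [fderiv_comp z hf (hτ.restrictScalars ℝ), hτ.fderiv_restrictScalars ℝ]
  simp [delAt, h]

/-- Chain rule for `∂∂̄`: it commutes with pull-back by a holomorphic map. -/
theorem leviAt_comp {f : E → ℂ} {τ : E → E} {z : E} (hf : ContDiffAt ℝ 2 f (τ z))
    (hτ : ContDiffAt ℂ 2 τ z) (t s : E) :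
    leviAt (f ∘ τ) z t s = leviAt f (τ z) (fderiv ℂ τ z t) (fderiv ℂ τ z s) := by
  have hτ1 : ∀ᶠ w in 𝓝 z, DifferentiableAt ℂ τ w :=
    (hτ.eventually (by simp)).mono fun w hw => hw.differentiableAt (by simp)
  have hf1 : ∀ᶠ w in 𝓝 z, DifferentiableAt ℝ f (τ w) :=
    hτ.continuousAt.eventually
      ((hf.eventually (by simp)).mono fun w hw => hw.differentiableAt (by simp))
  have h1 : ∀ v : E, (fun w => fderiv ℝ (f ∘ τ) w v) =ᶠ[𝓝 z]
      fun w => fderiv ℝ f (τ w) (fderiv ℂ τ w v) := fun v => by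
    filter_upwards [hτ1, hf1] with w hw1 hw2
    rw [fderiv_comp w hw2 (hw1.restrictScalars ℝ), hw1.fderiv_restrictScalars ℝ]
    rfl
  have hτr : ContDiffAt ℝ 2 τ z := hτ.restrict_scalars ℝ
  have hdf : DifferentiableAt ℝ (fderiv ℝ f) (τ z) :=
    (hf.fderiv_right (m := 1) (by norm_num)).differentiableAt (by simp)
  have hdτ : DifferentiableAt ℂ (fderiv ℂ τ) z :=
    (hτ.fderiv_right (m := 1) (by norm_num)).differentiableAt (by simp)
  have hdc : DifferentiableAt ℝ (fderiv ℝ (f ∘ τ)) z :=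
    ((hf.comp z hτr).fderiv_right (m := 1) (by norm_num)).differentiableAt (by simp)
  have hτz : DifferentiableAt ℂ τ z := hτ1.self_of_nhds
  have key : ∀ w v : E, fderiv ℝ (fderiv ℝ (f ∘ τ)) z w v =
      fderiv ℝ (fderiv ℝ f) (τ z) (fderiv ℂ τ z w) (fderiv ℂ τ z v)
        + fderiv ℝ f (τ z) (fderiv ℂ (fderiv ℂ τ) z w v) := fun w v => by
    have e1 : fderiv ℝ (fderiv ℝ (f ∘ τ)) z w v
        = fderiv ℝ (fun y => fderiv ℝ (f ∘ τ) y v) z w := by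
      rw [fderiv_clm_apply hdc (differentiableAt_const v)]
      simp
    have hA : HasFDerivAt (fun y => fderiv ℝ f (τ y))
        ((fderiv ℝ (fderiv ℝ f) (τ z)).comp ((fderiv ℂ τ z).restrictScalars ℝ)) z :=
      hdf.hasFDerivAt.comp z (hτz.hasFDerivAt.restrictScalars ℝ)
    have hB : HasFDerivAt (fun y => fderiv ℂ τ y v)
        (((fderiv ℂ (fderiv ℂ τ) z).flip v).restrictScalars ℝ) z := by
      have := hdτ.hasFDerivAt.clm_apply (hasFDerivAt_const v z)
      simpa using this.restrictScalars ℝ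
    rw [e1, (h1 v).fderiv_eq, (hA.clm_apply hB).fderiv]
    simp [add_comm]
  have hI : Complex.I • Complex.I • fderiv ℂ (fderiv ℂ τ) z t s
      = -fderiv ℂ (fderiv ℂ τ) z t s := by
    rw [smul_smul, Complex.I_mul_I, neg_one_smul]
  simp only [leviAt, LinearMap.mk₂'ₛₗ_apply, key, map_smul, smul_apply, hI, map_neg]
  ring

theorem contDiffOn_delAt {f : E → ℂ} {O : Set E} (hO : IsOpen O) (hf : ContDiffOn ℝ ∞ f O)
    (t : E) : ContDiffOn ℝ ∞ (fun z => delAt f z t) O := by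
  have h : ContDiffOn ℝ ∞ (fderiv ℝ f) O := hf.fderiv_of_isOpen hO (by simp)
  exact contDiffOn_const.mul ((h.clm_apply contDiffOn_const).sub
    (contDiffOn_const.mul (h.clm_apply contDiffOn_const)))

theorem contDiffOn_leviAt {f : E → ℂ} {O : Set E} (hO : IsOpen O) (hf : ContDiffOn ℝ ∞ f O)
    (t s : E) : ContDiffOn ℝ ∞ (fun z => leviAt f z t s) O := by
  have h : ContDiffOn ℝ ∞ (fderiv ℝ (fderiv ℝ f)) O :=
    (hf.fderiv_of_isOpen hO (m := ∞) (by simp)).fderiv_of_isOpen hO (by simp)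
  have h2 : ∀ a b : E, ContDiffOn ℝ ∞ (fun z => fderiv ℝ (fderiv ℝ f) z a b) O := fun a b =>
    (h.clm_apply contDiffOn_const).clm_apply contDiffOn_const
  exact contDiffOn_const.mul (((h2 _ _).add (h2 _ _)).add
    (contDiffOn_const.mul ((h2 _ _).sub (h2 _ _))))

end LocalCalculus

theorem eventuallyEq_transition {E : Type*} [NormedAddCommGroup E] {M : Type*}
    [TopologicalSpace M] [ChartedSpace E M] (u : M → ℂ) {e : OpenPartialHomeomorph M E} {z : E}
    (hz : z ∈ e.target) :
    u ∘ e.symm =ᶠ[𝓝 z]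
      (u ∘ (chartAt E (e.symm z)).symm) ∘ (chartAt E (e.symm z) ∘ e.symm) := by
  have h : e.symm ⁻¹' (chartAt E (e.symm z)).source ∈ 𝓝 z :=
    (e.continuousAt_symm hz).preimage_mem_nhds (chart_source_mem_nhds E _)
  filter_upwards [h] with w hw
  simp only [Function.comp_apply, (chartAt E (e.symm z)).left_inv hw]

section Forms

variable (E : Type*) [NormedAddCommGroup E] [NormedSpace ℂ E]
  {M : Type*} [TopologicalSpace M] [ChartedSpace E M]

variable (M) in
/-- Fields of `(1,1)`-forms on `M` (no regularity). A `(1,1)`-form `i ∑ⱼₖ hⱼₖ dzⱼ ∧ dz̄ₖ` is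
represented by the sesquilinear form `(t, s) ↦ ∑ⱼₖ hⱼₖ tⱼ s̄ₖ` on each complex tangent space. So real
forms are the Hermitian ones, positive forms are the positive semidefinite ones, and, for a
`(1,0)`-covector `a` and a `(0,1)`-covector `b`, `i a ∧ b` is `(t, s) ↦ a t * b s`. -/
abbrev Form11 : Type _ :=
  ∀ x : M, TangentSpace 𝓘(ℂ, E) x →ₗ[ℂ] TangentSpace 𝓘(ℂ, E) x →ₗ⋆[ℂ] ℂ

variable (M) in
/-- Fields of `(1,0)`-forms on `M`: complex linear functionals on the tangent spaces. -/
abbrev Form10 : Type _ := ∀ x : M, TangentSpace 𝓘(ℂ, E) x →ₗ[ℂ] ℂ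

variable (M) in
/-- Fields of `(0,1)`-forms on `M`: conjugate linear functionals on the tangent spaces. -/
abbrev Form01 : Type _ := ∀ x : M, TangentSpace 𝓘(ℂ, E) x →ₗ⋆[ℂ] ℂ

/-- The `(1,0)`-form `∂u`. The tangent space of `M` at `x` is `E`, by means of the preferred chart
at `x`, in which the derivative is computed. -/
def del (u : M → ℂ) : Form10 E M :=
  fun x => (delAt (E := E) (u ∘ (chartAt E x).symm) (chartAt E x x) : E →ₗ[ℂ] ℂ)

/-- The `(1,1)`-form `i∂∂̄u`. -/
def ddbar (u : M → ℂ) : Form11 E M :=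
  fun x => (leviAt (E := E) (u ∘ (chartAt E x).symm) (chartAt E x x) : E →ₗ[ℂ] E →ₗ⋆[ℂ] ℂ)

variable {E}

/-- The `(1,1)`-form `i a ∧ b`. -/
def iWedge (a : Form10 E M) (b : Form01 E M) : Form11 E M :=
  fun x => (a x).smulRight (b x)

/-- The coefficient, at the point `z` of the target of the chart `e`, of the `(1,1)`-form `φ` with
respect to the constant vectors `t` and `s`. -/
def coeff (φ : Form11 E M) (e : OpenPartialHomeomorph M E) (t s : E) (z : E) : ℂ :=
  φ (e.symm z) (mfderiv 𝓘(ℂ, E) 𝓘(ℂ, E) e.symm z t) (mfderiv 𝓘(ℂ, E) 𝓘(ℂ, E) e.symm z s)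

/-- The coefficient of a `(0,1)`-form in a chart. -/
def coeff01 (β : Form01 E M) (e : OpenPartialHomeomorph M E) (s : E) (z : E) : ℂ :=
  β (e.symm z) (mfderiv 𝓘(ℂ, E) 𝓘(ℂ, E) e.symm z s)

/-- `φ` is `C^∞` (in the real sense) on the open set `W`: all its coefficients in charts are. -/
def IsSmoothForm (φ : Form11 E M) (W : Set M) : Prop :=
  ∀ e ∈ atlas E M, ∀ t s : E, ContDiffOn ℝ ∞ (coeff φ e t s) (e.target ∩ e.symm ⁻¹' W)

variable (E) in
/-- Complex valued test functions (smooth with compact support) with support in `W`. -/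
structure IsTestFun (W : Set M) (χ : M → ℂ) : Prop where
  smooth : ContMDiff 𝓘(ℝ, E) 𝓘(ℝ, ℂ) ∞ χ
  compact : HasCompactSupport χ
  subset : tsupport χ ⊆ W

/-- Smooth `(0,1)`-forms with compact support in `W`. -/
structure IsTestForm01 (W : Set M) (β : Form01 E M) : Prop where
  smooth : ∀ e ∈ atlas E M, ∀ s : E, ContDiffOn ℝ ∞ (coeff01 β e s) e.target
  compact : ∃ K ⊆ W, IsCompact K ∧ ∀ x ∉ K, β x = 0

variable (E M) in
/-- The space of test forms of bidegree `(1,1)`: smooth `(1,1)`-forms with compact support. -/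
def TestForm11 : Submodule ℂ (Form11 E M) where
  carrier := {φ | IsSmoothForm φ univ ∧ ∃ K, IsCompact K ∧ ∀ x ∉ K, φ x = 0}
  zero_mem' := ⟨fun e _ t s => contDiffOn_const (c := (0 : ℂ)), ∅, isCompact_empty, fun _ _ => rfl⟩
  add_mem' := by
    rintro φ ψ ⟨h1, K, hK, h2⟩ ⟨h1', K', hK', h2'⟩
    refine ⟨fun e he t s => (h1 e he t s).add (h1' e he t s), K ∪ K', hK.union hK', fun x hx => ?_⟩
    rw [Pi.add_apply, h2 x fun h => hx (Or.inl h), h2' x fun h => hx (Or.inr h), add_zero]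
  smul_mem' := by
    rintro c φ ⟨h1, K, hK, h2⟩
    refine ⟨fun e he t s => contDiffOn_const.mul (h1 e he t s), K, hK, fun x hx => ?_⟩
    rw [Pi.smul_apply, h2 x hx, smul_zero]

/-- A holomorphic atlas is in particular a smooth one. -/
theorem isManifold_real [IsManifold 𝓘(ℂ, E) ω M] : IsManifold 𝓘(ℝ, E) ∞ M := by
  refine isManifold_of_contDiffOn _ _ _ fun e e' he he' => ?_
  have h := (contDiffGroupoid ω 𝓘(ℂ, E)).compatible he he'
  have h' := (contDiffGroupoid_le (I := 𝓘(ℂ, E)) (le_top : (∞ : ℕ∞ω) ≤ ω)) h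
  have h'' : ContDiffOn ℂ ∞ (𝓘(ℂ, E) ∘ e.symm ≫ₕ e' ∘ 𝓘(ℂ, E).symm)
      (𝓘(ℂ, E).symm ⁻¹' (e.symm ≫ₕ e').source ∩ range 𝓘(ℂ, E)) :=
    (mem_groupoid_of_pregroupoid.1 h').1
  exact h''.restrict_scalars ℝ

theorem contDiffOn_comp_symm [IsManifold 𝓘(ℂ, E) ω M] {u : M → ℂ} {W : Set M}
    (hu : ContMDiffOn 𝓘(ℝ, E) 𝓘(ℝ, ℂ) ∞ u W) {e : OpenPartialHomeomorph M E}
    (he : e ∈ atlas E M) : ContDiffOn ℝ ∞ (u ∘ e.symm) (e.target ∩ e.symm ⁻¹' W) := by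
  have : IsManifold 𝓘(ℝ, E) ∞ M := isManifold_real
  have h := contMDiffOn_symm_of_mem_maximalAtlas (I := 𝓘(ℝ, E)) (n := ∞)
    (IsManifold.subset_maximalAtlas he)
  exact contMDiffOn_iff_contDiffOn.1
    (hu.comp (h.mono inter_subset_left) fun z hz => hz.2)

/-- Transition to the preferred chart, and the derivative of the inverse of a chart. -/
theorem transition [IsManifold 𝓘(ℂ, E) ω M] {e : OpenPartialHomeomorph M E}
    (he : e ∈ atlas E M) {z : E} (hz : z ∈ e.target) :
    ContDiffAt ℂ ω (chartAt E (e.symm z) ∘ e.symm) z ∧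
      (mfderiv 𝓘(ℂ, E) 𝓘(ℂ, E) e.symm z : E → E) =
        fderiv ℂ (chartAt E (e.symm z) ∘ e.symm) z := by
  have h := contMDiffOn_symm_of_mem_maximalAtlas (I := 𝓘(ℂ, E)) (n := ω)
    (IsManifold.subset_maximalAtlas he)
  have h1 : ContMDiffAt 𝓘(ℂ, E) 𝓘(ℂ, E) ω e.symm z := h.contMDiffAt (e.open_target.mem_nhds hz)
  have h2 : ContMDiffAt 𝓘(ℂ, E) 𝓘(ℂ, E) ω (chartAt E (e.symm z)) (e.symm z) :=
    contMDiffAt_of_mem_maximalAtlas (IsManifold.chart_mem_maximalAtlas _) (mem_chart_source _ _)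
  refine ⟨contMDiffAt_iff_contDiffAt.1 (h2.comp z h1), ?_⟩
  have h3 : MDifferentiableAt 𝓘(ℂ, E) 𝓘(ℂ, E) e.symm z := h1.mdifferentiableAt (by simp)
  rw [h3.mfderiv]
  simp only [writtenInExtChartAt, extChartAt, mfld_simps, fderivWithin_univ]
  rfl

theorem contDiffAt_preferred [IsManifold 𝓘(ℂ, E) ω M] {u : M → ℂ} {W : Set M} (hW : IsOpen W)
    (hu : ContMDiffOn 𝓘(ℝ, E) 𝓘(ℝ, ℂ) ∞ u W) {x : M} (hx : x ∈ W) :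
    ContDiffAt ℝ ∞ (u ∘ (chartAt E x).symm) (chartAt E x x) := by
  refine (contDiffOn_comp_symm hu (chart_mem_atlas E x)).contDiffAt
    ((OpenPartialHomeomorph.isOpen_inter_preimage_symm _ hW).mem_nhds ⟨mem_chart_target E x, ?_⟩)
  simpa using hx

/-- In every chart `e` of the atlas, `∂u` is computed as `∂(u ∘ e⁻¹)`. -/
theorem del_chart [IsManifold 𝓘(ℂ, E) ω M] {u : M → ℂ} {W : Set M} (hW : IsOpen W)
    (hu : ContMDiffOn 𝓘(ℝ, E) 𝓘(ℝ, ℂ) ∞ u W) {e : OpenPartialHomeomorph M E}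
    (he : e ∈ atlas E M) {z : E} (hz : z ∈ e.target ∩ e.symm ⁻¹' W) (t : E) :
    del E u (e.symm z) (mfderiv 𝓘(ℂ, E) 𝓘(ℂ, E) e.symm z t) = delAt (u ∘ e.symm) z t := by
  obtain ⟨h1, h2⟩ := transition he hz.1
  have h3 := contDiffAt_preferred hW hu hz.2
  have h4 : delAt (u ∘ e.symm) z t = delAt ((u ∘ (chartAt E (e.symm z)).symm) ∘
      (chartAt E (e.symm z) ∘ e.symm)) z t := by
    simp only [delAt, (eventuallyEq_transition u hz.1).fderiv_eq]
  rw [h4, delAt_comp (h3.differentiableAt (by simp)) (h1.differentiableAt (by simp)), ← h2]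
  rfl

/-- In every chart `e` of the atlas, `i∂∂̄u` is computed as `i∂∂̄(u ∘ e⁻¹)`. -/
theorem ddbar_chart [IsManifold 𝓘(ℂ, E) ω M] {u : M → ℂ} {W : Set M} (hW : IsOpen W)
    (hu : ContMDiffOn 𝓘(ℝ, E) 𝓘(ℝ, ℂ) ∞ u W) {e : OpenPartialHomeomorph M E}
    (he : e ∈ atlas E M) {z : E} (hz : z ∈ e.target ∩ e.symm ⁻¹' W) (t s : E) :
    coeff (ddbar E u) e t s z = leviAt (u ∘ e.symm) z t s := by
  obtain ⟨h1, h2⟩ := transition he hz.1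
  have h3 := contDiffAt_preferred hW hu hz.2
  have h4 : leviAt (u ∘ e.symm) z t s = leviAt ((u ∘ (chartAt E (e.symm z)).symm) ∘
      (chartAt E (e.symm z) ∘ e.symm)) z t s := by
    simp only [leviAt, LinearMap.mk₂'ₛₗ_apply, (eventuallyEq_transition u hz.1).fderiv.fderiv_eq]
  rw [h4, leviAt_comp (h3.of_le (WithTop.coe_le_coe.2 (le_top : (2 : ℕ∞) ≤ ⊤))) (h1.of_le le_top), ← h2]
  rfl

theorem ddbar_smooth [IsManifold 𝓘(ℂ, E) ω M] {u : M → ℂ} {W : Set M} (hW : IsOpen W)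
    (hu : ContMDiffOn 𝓘(ℝ, E) 𝓘(ℝ, ℂ) ∞ u W) : IsSmoothForm (ddbar E u) W :=
  fun _ he t s => (contDiffOn_leviAt (OpenPartialHomeomorph.isOpen_inter_preimage_symm _ hW) (contDiffOn_comp_symm hu he) t s).congr
    fun _ hz => ddbar_chart hW hu he hz t s

/-- A form that is smooth on `W` and vanishes off a compact subset of `W` is a test form. -/
theorem mem_testForm11 [T2Space M] {φ : Form11 E M} {W : Set M} (hW : IsOpen W)
    (hφ : IsSmoothForm φ W)
    {K : Set M} (hK : IsCompact K) (hKW : K ⊆ W) (h0 : ∀ x ∉ K, φ x = 0) :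
    φ ∈ TestForm11 E M := by
  refine ⟨fun e he t s z hz => ?_, K, hK, h0⟩
  refine ContDiffAt.contDiffWithinAt ?_
  by_cases hx : e.symm z ∈ K
  · exact (hφ e he t s).contDiffAt ((e.isOpen_inter_preimage_symm hW).mem_nhds ⟨hz.1, hKW hx⟩)
  · have hn : e.symm ⁻¹' Kᶜ ∈ 𝓝 z :=
      (e.continuousAt_symm hz.1).preimage_mem_nhds (hK.isClosed.isOpen_compl.mem_nhds hx)
    have : coeff φ e t s =ᶠ[𝓝 z] fun _ => (0 : ℂ) := by
      filter_upwards [hn] with w hw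
      rw [coeff, h0 _ hw]
      rfl
    exact contDiffAt_const.congr_of_eventuallyEq this

/-- The test form `χ φ`, for a test function `χ` and a form `φ` smooth on a neighborhood of the
support of `χ`. -/
def cutoff [IsManifold 𝓘(ℂ, E) ω M] [T2Space M] {W : Set M} (hW : IsOpen W) (φ : Form11 E M)
    (hφ : IsSmoothForm φ W) (χ : M → ℂ) (hχ : IsTestFun E W χ) : TestForm11 E M :=
  ⟨fun x => χ x • φ x, by
    refine mem_testForm11 hW (fun e he t s => ?_) hχ.compact hχ.subset fun x hx => ?_
    · exact (contDiffOn_comp_symm hχ.smooth.contMDiffOn he).mul (hφ e he t s)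
    · rw [image_eq_zero_of_notMem_tsupport hx, zero_smul]⟩

/-- The test form `i ∂u ∧ β`, for a function `u` smooth on the open set `W` and a test form `β` of
bidegree `(0,1)` with support in `W`. -/
def delWedge [IsManifold 𝓘(ℂ, E) ω M] [T2Space M] {W : Set M} (hW : IsOpen W) (u : M → ℂ)
    (hu : ContMDiffOn 𝓘(ℝ, E) 𝓘(ℝ, ℂ) ∞ u W) (β : Form01 E M) (hβ : IsTestForm01 W β) :
    TestForm11 E M :=
  ⟨iWedge (del E u) β, by
    obtain ⟨K, hKW, hK, h0⟩ := hβ.compact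
    refine mem_testForm11 hW (fun e he t s => ?_) hK hKW fun x hx => ?_
    · have h1 := contDiffOn_delAt (OpenPartialHomeomorph.isOpen_inter_preimage_symm e hW)
        (contDiffOn_comp_symm hu he) t
      refine (h1.mul ((hβ.smooth e he s).mono inter_subset_left)).congr fun z hz => ?_
      rw [← del_chart hW hu he hz t]
      rfl
    · rw [iWedge, h0 x hx, LinearMap.smulRight_zero]⟩

/-- The test form `i∂∂̄u`, for a test function `u`. -/
def ddbarTest [IsManifold 𝓘(ℂ, E) ω M] [T2Space M] (u : M → ℂ) (hu : IsTestFun E univ u) :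
    TestForm11 E M :=
  ⟨ddbar E u, by
    refine mem_testForm11 isOpen_univ (ddbar_smooth isOpen_univ hu.smooth.contMDiffOn) hu.compact
      (subset_univ _) fun x hx => ?_
    have h0 : u =ᶠ[𝓝 x] fun _ => 0 := notMem_tsupport_iff_eventuallyEq.1 hx
    have h1 : Tendsto (chartAt E x).symm (𝓝 (chartAt E x x)) (𝓝 x) := by
      have := (chartAt E x).continuousAt_symm (mem_chart_target E x)
      rwa [ContinuousAt, (chartAt E x).left_inv (mem_chart_source E x)] at this
    have h2 : u ∘ (chartAt E x).symm =ᶠ[𝓝 (chartAt E x x)] fun _ => (0 : ℂ) := h1.eventually h0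
    have h3 := h2.fderiv (𝕜 := ℝ)
    have h4 : fderiv ℝ (fderiv ℝ (u ∘ (chartAt E x).symm)) (chartAt E x x) = 0 := by
      rw [h3.fderiv_eq]
      simp
    refine LinearMap.ext fun t => LinearMap.ext fun s => ?_
    simp only [ddbar, leviAt, h4]
    simp only [zero_apply, add_zero, sub_zero, mul_zero]
    rfl⟩

variable (E M) in
/-- A sequence of test forms tends to zero: the supports stay in a fixed compact set, and in all
charts all derivatives of the coefficients tend to zero uniformly on compact sets. -/
def TendsToZero (φ : ℕ → TestForm11 E M) : Prop :=
  (∃ K : Set M, IsCompact K ∧ ∀ j, ∀ x ∉ K, (φ j : Form11 E M) x = 0) ∧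
    ∀ e ∈ atlas E M, ∀ t s : E, ∀ k : ℕ, ∀ L ⊆ e.target, IsCompact L →
      TendstoUniformlyOn (fun j z => iteratedFDeriv ℝ k (coeff (φ j : Form11 E M) e t s) z)
        0 atTop L

variable (E M) in
/-- Currents of bidimension `(1,1)`: complex linear functionals on the space of test forms of
bidegree `(1,1)` that are continuous for the usual inductive limit topology. (On each Fréchet space
of forms with support in a fixed compact set, continuity is sequential continuity.) -/
structure Current11 where
  toFun : TestForm11 E M →ₗ[ℂ] ℂ
  continuous : ∀ φ : ℕ → TestForm11 E M, TendsToZero E M φ →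
    Tendsto (fun j => toFun (φ j)) atTop (𝓝 0)

/-- A positive `(1,1)`-form (`0 ≤ w` for complex `w` means that `w` is a real number `≥ 0`). -/
def IsPositiveForm (φ : Form11 E M) : Prop := ∀ x t, 0 ≤ φ x t t

/-- A positive current. -/
def Current11.IsPositive (T : Current11 E M) : Prop :=
  ∀ φ : TestForm11 E M, IsPositiveForm (φ : Form11 E M) → 0 ≤ T.toFun φ

/-- `T` has its support in the closed set `F`. -/
def Current11.IsSupportedIn (T : Current11 E M) (F : Set M) : Prop :=
  ∀ φ : TestForm11 E M, Disjoint (closure {x | (φ : Form11 E M) x ≠ 0}) F → T.toFun φ = 0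

/-- `i∂∂̄T = 0`. -/
def Current11.IsDdbarClosed [IsManifold 𝓘(ℂ, E) ω M] [T2Space M] (T : Current11 E M) : Prop :=
  ∀ (u : M → ℂ) (hu : IsTestFun E univ u), T.toFun (ddbarTest u hu) = 0

variable (E M) in
/-- A Hermitian metric on `M`, given by its fundamental form: a smooth (real) positive definite
`(1,1)`-form. -/
structure HermitianMetric where
  form : Form11 E M
  smooth : IsSmoothForm form univ
  pos : ∀ x t, t ≠ 0 → 0 < form x t t

variable (E) in
/-- A smooth defining function `r`, on a neighborhood `nhd` of the closure of `U`, of the set `U`: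
`U = {r < 0}` and `dr ≠ 0` on `∂U`. -/
structure DefiningFunction (U : Set M) where
  nhd : Set M
  r : M → ℝ
  isOpen_nhd : IsOpen nhd
  closure_subset : closure U ⊆ nhd
  smooth : ContMDiffOn 𝓘(ℝ, E) 𝓘(ℝ, ℝ) ∞ r nhd
  eq : U = {x ∈ nhd | r x < 0}
  mfderiv_ne_zero : ∀ x ∈ frontier U, mfderiv 𝓘(ℝ, E) 𝓘(ℝ, ℝ) r x ≠ 0

/-- The defining function as a complex valued function. -/
def DefiningFunction.rC {U : Set M} (ρ : DefiningFunction E U) : M → ℂ := fun x => (ρ.r x : ℂ)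

theorem DefiningFunction.smooth_rC {U : Set M} (ρ : DefiningFunction E U) :
    ContMDiffOn 𝓘(ℝ, E) 𝓘(ℝ, ℂ) ∞ ρ.rC ρ.nhd :=
  Complex.ofRealCLM.contMDiff.comp_contMDiffOn ρ.smooth

/-- Pseudoconvexity: on `∂U` the Levi form of `r` is nonnegative on the complex tangent vectors. -/
def DefiningFunction.IsPseudoconvex {U : Set M} (ρ : DefiningFunction E U) : Prop :=
  ∀ x ∈ frontier U, ∀ t : TangentSpace 𝓘(ℂ, E) x,
    del E ρ.rC x t = 0 → 0 ≤ ddbar E ρ.rC x t t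

/-- `T` is a Levi current on `∂U`: a positive current of bidimension `(1,1)` supported on `∂U`
with `T ∧ ∂r = 0`, `T ∧ ∂∂̄r = 0`, `i∂∂̄T = 0` and `⟨T, ω⟩ = 1`. The first two equations are tested
on forms with compact support in the domain `nhd` of `r`. Since the support of `T` is compact,
`⟨T, ω⟩` is `⟨T, χ ω⟩` for any test function `χ` that is `1` near `∂U`. -/
structure IsLeviCurrent [IsManifold 𝓘(ℂ, E) ω M] [T2Space M] (g : HermitianMetric E M)
    {U : Set M} (ρ : DefiningFunction E U) (T : Current11 E M) : Prop where
  positive : T.IsPositive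
  supported : T.IsSupportedIn (frontier U)
  wedge_del : ∀ (β : Form01 E M) (hβ : IsTestForm01 ρ.nhd β),
    T.toFun (delWedge ρ.isOpen_nhd ρ.rC ρ.smooth_rC β hβ) = 0
  wedge_ddbar : ∀ (χ : M → ℂ) (hχ : IsTestFun E ρ.nhd χ),
    T.toFun (cutoff ρ.isOpen_nhd (ddbar E ρ.rC) (ddbar_smooth ρ.isOpen_nhd ρ.smooth_rC) χ hχ) = 0
  ddbar_closed : T.IsDdbarClosed
  mass : ∀ (χ : M → ℂ) (hχ : IsTestFun E univ χ), (∀ᶠ x in 𝓝ˢ (frontier U), χ x = 1) →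
    T.toFun (cutoff isOpen_univ g.form g.smooth χ hχ) = 1

variable (E) in
/-- `u` is smooth and strictly plurisubharmonic on the open set `V`: its Levi form is positive
definite. -/
structure IsSmoothStrictlyPshOn (u : M → ℝ) (V : Set M) : Prop where
  smooth : ContMDiffOn 𝓘(ℝ, E) 𝓘(ℝ, ℝ) ∞ u V
  pos : ∀ x ∈ V, ∀ t : TangentSpace 𝓘(ℂ, E) x, t ≠ 0 →
    0 < ddbar E (fun y => (u y : ℂ)) x t t

end Forms

end LeviCurrent

end

/-!
The idea is to look at a `(1,1)`-form `φ` as the function `(x, t) ↦ φ x t t` (`diag φ`) on the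
tangent bundle. The unit sphere bundle of the metric over a compact set is compact
(`HermitianMetric.isCompact_sphere`), so strict positivity of forms is an open condition and
penalty arguments are available.

Suppose first that `u` is strictly plurisubharmonic near `∂U`, and let `χ` be a cutoff function.
Then `χ (i∂∂̄u - c ω)` is a positive form for small `c > 0`. On it, a Levi current would take the
value `-c`, since near `∂U` the form `χ i∂∂̄u` is `i∂∂̄(χ u)`, which is absurd
(`not_isLeviCurrent_of_strictlyPsh`).

Conversely, let `N` be the compact set of unit vectors `t` at points of `∂U` with `∂r(t) = 0` and
`i∂∂̄r(t, t) = 0` (`DefiningFunction.nullVectors`). By the Hahn-Banach theorem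
(`exists_positive_functional`), either some test function has a Levi form that is positive on `N`,
or some normalized positive functional `Λ` on `C(N)` annihilates the Levi forms of all test
functions. In the second case `φ ↦ Λ ((x, t) ↦ φ x t t)` is a Levi current: the equations
`T ∧ ∂r = 0` and `T ∧ ∂∂̄r = 0` hold because of the choice of `N`
(`DefiningFunction.isLeviCurrent_ofFunctional`). So, if there is no Levi current, there is a test
function `u` with `i∂∂̄u > 0` on `N`. On `∂U`, the Levi form of `u + A r + B r²` is
`i∂∂̄u(t, t) + A i∂∂̄r(t, t) + 2 B |∂r(t)|²`. By pseudoconvexity, a large `A` makes it positive on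
the complex tangent vectors, and then a large `B` makes it positive on all nonzero vectors
(`DefiningFunction.exists_strictlyPsh`).
-/

noncomputable section

namespace LeviCurrent

variable {E : Type*} [NormedAddCommGroup E] [NormedSpace ℂ E]
  {M : Type*} [TopologicalSpace M] [ChartedSpace E M]

/-! ### Forms as functions on the tangent bundle -/

/-- The function `(x, t) ↦ φ x t t` on the tangent bundle. -/
def diag (φ : Form11 E M) (p : TangentBundle 𝓘(ℂ, E) M) : ℂ := φ p.1 p.2 p.2

theorem form_smul_smul (φ : Form11 E M) (x : M) (c : ℝ) (t : TangentSpace 𝓘(ℂ, E) x) :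
    φ x ((c : ℂ) • t) ((c : ℂ) • t) = (c : ℂ) ^ 2 * φ x t t := by
  simp only [map_smul, LinearMap.smul_apply, LinearMap.map_smulₛₗ, Complex.conj_ofReal,
    smul_eq_mul]
  ring

theorem form_eq_of_eq (φ : Form11 E M) {x y : M} (h : y = x) (v : E) :
    φ y (v : TangentSpace 𝓘(ℂ, E) y) (v : TangentSpace 𝓘(ℂ, E) y) =
      φ x (v : TangentSpace 𝓘(ℂ, E) x) (v : TangentSpace 𝓘(ℂ, E) x) := by
  subst h
  rfl

/-- In the trivialization given by a preferred chart, `diag φ` is the quadratic form of the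
coefficients of `φ` in that chart. -/
theorem diag_eq_coeff [IsManifold 𝓘(ℂ, E) ω M] (φ : Form11 E M) (x₀ : M)
    {p : TangentBundle 𝓘(ℂ, E) M} (hp : p.1 ∈ (chartAt E x₀).source) :
    diag φ p = coeff φ (chartAt E x₀)
      (trivializationAt E (TangentSpace 𝓘(ℂ, E)) x₀ p).2
      (trivializationAt E (TangentSpace 𝓘(ℂ, E)) x₀ p).2 (chartAt E x₀ p.1) := by
  have hb : p.1 ∈ (trivializationAt E (TangentSpace 𝓘(ℂ, E)) x₀).baseSet := hp
  have h1 := TangentBundle.symmL_trivializationAt (I := 𝓘(ℂ, E)) hp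
  have h2 : (mfderiv 𝓘(ℂ, E) 𝓘(ℂ, E) (chartAt E x₀).symm (chartAt E x₀ p.1)
      (trivializationAt E (TangentSpace 𝓘(ℂ, E)) x₀ p).2 : E) = p.2 := by
    have h3 : (trivializationAt E (TangentSpace 𝓘(ℂ, E)) x₀).symmL ℂ p.1
        (trivializationAt E (TangentSpace 𝓘(ℂ, E)) x₀ p).2 = p.2 :=
      (Bundle.Trivialization.symmL_apply _ hb _).trans
        (Bundle.Trivialization.symm_proj_apply _ _ hb)
    rw [h1] at h3
    simp only [extChartAt, mfld_simps, mfderivWithin_univ] at h3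
    exact h3
  have h4 : (chartAt E x₀).symm (chartAt E x₀ p.1) = p.1 := (chartAt E x₀).left_inv hp
  rw [coeff]
  refine (form_eq_of_eq φ h4 p.2).symm.trans ?_
  rw [← h2]

theorem coeff_eq_sum (φ : Form11 E M) (e : OpenPartialHomeomorph M E) {ι : Type*} [Fintype ι]
    (b : Module.Basis ι ℂ E) (s z : E) :
    coeff φ e s s z = ∑ i, ∑ j, b.repr s i * starRingEnd ℂ (b.repr s j) *
      coeff φ e (b i) (b j) z := by
  have h : ∀ L : E →ₗ[ℂ] E →ₗ⋆[ℂ] ℂ, L s s = ∑ i, ∑ j, b.repr s i * starRingEnd ℂ (b.repr s j) *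
      L (b i) (b j) := fun L => by
    conv_lhs => rw [← b.sum_repr s]
    simp only [map_sum, LinearMap.sum_apply, map_smul, LinearMap.smul_apply,
      LinearMap.map_smulₛₗ, smul_eq_mul, mul_assoc, Finset.mul_sum]
    rw [Finset.sum_comm]
    exact Finset.sum_congr rfl fun i _ => Finset.sum_congr rfl fun j _ => mul_left_comm _ _ _
  let D : E →ₗ[ℂ] TangentSpace 𝓘(ℂ, E) (e.symm z) :=
    (mfderiv 𝓘(ℂ, E) 𝓘(ℂ, E) e.symm z).toLinearMap
  exact h (((φ (e.symm z)).comp D).compl₂ D)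

theorem continuous_repr [FiniteDimensional ℂ E] {ι : Type*} [Fintype ι]
    (b : Module.Basis ι ℂ E) (i : ι) : Continuous fun s : E => b.repr s i :=
  (b.coord i).continuous_of_finiteDimensional

theorem continuousOn_diag [FiniteDimensional ℂ E] [IsManifold 𝓘(ℂ, E) ω M] {φ : Form11 E M}
    {W : Set M} (hW : IsOpen W) (hφ : IsSmoothForm φ W) :
    ContinuousOn (diag φ) {p | p.1 ∈ W} := by
  intro p hp
  have hpr : Continuous fun q : TangentBundle 𝓘(ℂ, E) M => q.1 :=
    FiberBundle.continuous_proj E (TangentSpace 𝓘(ℂ, E))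
  set e := chartAt E p.1 with he
  set τ := trivializationAt E (TangentSpace 𝓘(ℂ, E)) p.1 with hτ
  have hsrc : p.1 ∈ e.source := mem_chart_source E p.1
  have hev : ∀ᶠ q : TangentBundle 𝓘(ℂ, E) M in 𝓝 p, q.1 ∈ e.source :=
    hpr.continuousAt.eventually (e.open_source.mem_nhds hsrc)
  have hτp : ContinuousAt (fun q => (τ q).2) p :=
    (τ.continuousAt (τ.mem_source.2 hsrc)).snd
  have hep : ContinuousAt (fun q : TangentBundle 𝓘(ℂ, E) M => e q.1) p :=
    ContinuousAt.comp (f := fun q : TangentBundle 𝓘(ℂ, E) M => q.1) (e.continuousAt hsrc)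
      hpr.continuousAt
  let b := Module.finBasis ℂ E
  refine ContinuousAt.continuousWithinAt ?_
  have hmem : e p.1 ∈ e.target ∩ e.symm ⁻¹' W := by
    refine ⟨e.map_source hsrc, ?_⟩
    rw [mem_preimage, e.left_inv hsrc]
    exact hp
  have h : ContinuousAt (fun q => ∑ i, ∑ j, b.repr (τ q).2 i *
      starRingEnd ℂ (b.repr (τ q).2 j) * coeff φ e (b i) (b j) (e q.1)) p := by
    refine tendsto_finsetSum _ fun i _ => tendsto_finsetSum _ fun j _ => ?_
    refine Tendsto.mul (Tendsto.mul ?_ ?_) ?_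
    · exact (continuous_repr b i).continuousAt.tendsto.comp hτp
    · exact ((Complex.continuous_conj.comp (continuous_repr b j)).continuousAt.tendsto).comp hτp
    · have hc : ContinuousAt (coeff φ e (b i) (b j)) (e p.1) :=
        ((hφ e (chart_mem_atlas E p.1) (b i) (b j)).contDiffAt
          ((e.isOpen_inter_preimage_symm hW).mem_nhds hmem)).continuousAt
      exact hc.tendsto.comp hep
  refine h.congr ?_
  filter_upwards [hev] with q hq
  rw [diag_eq_coeff φ p.1 hq, coeff_eq_sum φ _ b]

/-- Convergence to zero of test forms implies locally uniform convergence to zero of the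
associated functions on the tangent bundle. -/
theorem TendsToZero.tendstoLocallyUniformly_diag [FiniteDimensional ℂ E]
    [IsManifold 𝓘(ℂ, E) ω M] {φ : ℕ → TestForm11 E M} (hφ : TendsToZero E M φ) :
    TendstoLocallyUniformly (fun j => diag (φ j : Form11 E M)) 0 atTop := by
  rw [Metric.tendstoLocallyUniformly_iff]
  intro ε hε p
  have hpr : Continuous fun q : TangentBundle 𝓘(ℂ, E) M => q.1 :=
    FiberBundle.continuous_proj E (TangentSpace 𝓘(ℂ, E))
  set e := chartAt E p.1 with he
  set τ := trivializationAt E (TangentSpace 𝓘(ℂ, E)) p.1 with hτ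
  have hsrc : p.1 ∈ e.source := mem_chart_source E p.1
  have hτp : ContinuousAt (fun q => (τ q).2) p :=
    (τ.continuousAt (τ.mem_source.2 hsrc)).snd
  have hep : ContinuousAt (fun q : TangentBundle 𝓘(ℂ, E) M => e q.1) p :=
    ContinuousAt.comp (f := fun q : TangentBundle 𝓘(ℂ, E) M => q.1) (e.continuousAt hsrc)
      hpr.continuousAt
  let b := Module.finBasis ℂ E
  have : ProperSpace E := FiniteDimensional.proper ℂ E
  obtain ⟨L, hL, hLe, hLc⟩ := local_compact_nhds (e.open_target.mem_nhds (e.map_source hsrc))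
  -- The coordinates of the tangent vectors are bounded near `p`.
  let N : E → ℝ := fun s => ∑ i, ∑ j, ‖b.repr s i * starRingEnd ℂ (b.repr s j)‖
  have hN : Continuous N := by
    refine continuous_finsetSum _ fun i _ => continuous_finsetSum _ fun j _ => ?_
    exact ((continuous_repr b i).mul (Complex.continuous_conj.comp (continuous_repr b j))).norm
  have hN0 : 0 ≤ N (τ p).2 :=
    Finset.sum_nonneg fun i _ => Finset.sum_nonneg fun j _ => norm_nonneg _
  set R : ℝ := N (τ p).2 + 1 with hR
  have hRpos : 0 < R := by linarith
  have hNev : ∀ᶠ q in 𝓝 p, N (τ q).2 < R :=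
    (hN.continuousAt.tendsto.comp hτp).eventually (gt_mem_nhds (by simp [hR]))
  have hev : ∀ᶠ q : TangentBundle 𝓘(ℂ, E) M in 𝓝 p, q.1 ∈ e.source :=
    hpr.continuousAt.eventually (e.open_source.mem_nhds hsrc)
  have hLev : ∀ᶠ q : TangentBundle 𝓘(ℂ, E) M in 𝓝 p, e q.1 ∈ L := hep.eventually hL
  refine ⟨_, hNev.and (hev.and hLev), ?_⟩
  have hco : ∀ᶠ n in atTop, ∀ i j, ∀ z ∈ L,
      ‖coeff (φ n : Form11 E M) e (b i) (b j) z‖ < ε / R := by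
    refine eventually_all.2 fun i => eventually_all.2 fun j => ?_
    have h := hφ.2 e (chart_mem_atlas E p.1) (b i) (b j) 0 L hLe hLc
    rw [Metric.tendstoUniformlyOn_iff] at h
    filter_upwards [h (ε / R) (by positivity)] with n hn z hz
    simpa [dist_eq_norm] using hn z hz
  filter_upwards [hco] with n hn q ⟨hq1, hq2, hq3⟩
  rw [Pi.zero_apply, dist_zero_left, diag_eq_coeff _ p.1 hq2, coeff_eq_sum _ _ b]
  calc _ ≤ ∑ i, ∑ j, ‖b.repr (τ q).2 i * starRingEnd ℂ (b.repr (τ q).2 j)‖ * (ε / R) := by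
        refine (norm_sum_le _ _).trans (Finset.sum_le_sum fun i _ => ?_)
        refine (norm_sum_le _ _).trans (Finset.sum_le_sum fun j _ => ?_)
        rw [norm_mul]
        exact mul_le_mul_of_nonneg_left (hn i j _ hq3).le (norm_nonneg _)
    _ = N (τ q).2 * (ε / R) := by simp only [N, Finset.sum_mul]
    _ < R * (ε / R) := by gcongr
    _ = ε := by field_simp

/-! ### The unit sphere bundle -/

/-- The unit sphere bundle, over the subset `C` of `M`, of a Hermitian metric. -/
def HermitianMetric.sphere (g : HermitianMetric E M) (C : Set M) :
    Set (TangentBundle 𝓘(ℂ, E) M) :=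
  {p | p.1 ∈ C ∧ diag g.form p = 1}

theorem HermitianMetric.ne_zero_of_mem_sphere {g : HermitianMetric E M} {C : Set M}
    {p : TangentBundle 𝓘(ℂ, E) M} (hp : p ∈ g.sphere C) : p.2 ≠ 0 := by
  intro h
  have h1 := hp.2
  rw [diag, h] at h1
  simp at h1

/-- Every nonzero tangent vector is a positive multiple of a unit vector. -/
theorem HermitianMetric.exists_mem_sphere (g : HermitianMetric E M) {C : Set M} {x : M}
    (hx : x ∈ C) {t : TangentSpace 𝓘(ℂ, E) x} (ht : t ≠ 0) :
    ∃ (c : ℝ) (s : TangentSpace 𝓘(ℂ, E) x), 0 < c ∧ t = (c : ℂ) • s ∧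
      (⟨x, s⟩ : TangentBundle 𝓘(ℂ, E) M) ∈ g.sphere C := by
  have h0 := g.pos x t ht
  obtain ⟨a, ha⟩ : ∃ a : ℝ, g.form x t t = a := ⟨_, Complex.eq_re_of_ofReal_le h0.le⟩
  rw [ha, Complex.zero_lt_real] at h0
  have hs : 0 < √a := Real.sqrt_pos.2 h0
  refine ⟨√a, (((√a)⁻¹ : ℝ) : ℂ) • t, hs, ?_, hx, ?_⟩
  · rw [smul_smul, ← Complex.ofReal_mul, mul_inv_cancel₀ hs.ne', Complex.ofReal_one, one_smul]
  · rw [diag, form_smul_smul, ha, ← Complex.ofReal_pow, ← Complex.ofReal_mul, inv_pow,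
      Real.sq_sqrt h0.le, inv_mul_cancel₀ h0.ne', Complex.ofReal_one]

theorem HermitianMetric.continuous_diag [FiniteDimensional ℂ E] [IsManifold 𝓘(ℂ, E) ω M]
    (g : HermitianMetric E M) : Continuous (diag g.form) :=
  continuousOn_univ.1 ((continuousOn_diag isOpen_univ g.smooth).mono fun _ _ => mem_univ _)

theorem HermitianMetric.isClosed_sphere [FiniteDimensional ℂ E] [IsManifold 𝓘(ℂ, E) ω M]
    (g : HermitianMetric E M) {C : Set M} (hC : IsClosed C) : IsClosed (g.sphere C) :=
  (hC.preimage (FiberBundle.continuous_proj E (TangentSpace 𝓘(ℂ, E)))).inter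
    (isClosed_eq g.continuous_diag continuous_const)

theorem HermitianMetric.isCompact_sphere [FiniteDimensional ℂ E] [IsManifold 𝓘(ℂ, E) ω M]
    [T2Space M] (g : HermitianMetric E M) {C : Set M} (hC : IsCompact C) :
    IsCompact (g.sphere C) := by
  suffices h : ∃ D, IsCompact D ∧ g.sphere C ⊆ D by
    obtain ⟨D, hD, hCD⟩ := h
    exact hD.of_isClosed_subset (g.isClosed_sphere hC.isClosed) hCD
  refine hC.induction_on (p := fun C => ∃ D, IsCompact D ∧ g.sphere C ⊆ D)
    ⟨∅, isCompact_empty, fun p hp => hp.1⟩ ?_ ?_ fun x _ => ?_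
  · rintro s t hst ⟨D, hD, htD⟩
    exact ⟨D, hD, fun p hp => htD ⟨hst hp.1, hp.2⟩⟩
  · rintro s t ⟨D, hD, hsD⟩ ⟨D', hD', htD'⟩
    refine ⟨D ∪ D', hD.union hD', fun p hp => ?_⟩
    rcases hp.1 with h | h
    · exact Or.inl (hsD ⟨h, hp.2⟩)
    · exact Or.inr (htD' ⟨h, hp.2⟩)
  · have : ProperSpace E := FiniteDimensional.proper ℂ E
    have : LocallyCompactSpace M := ChartedSpace.locallyCompactSpace E M
    set τ := trivializationAt E (TangentSpace 𝓘(ℂ, E)) x with hτ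
    obtain ⟨C', hC', hC's, hC'c⟩ := local_compact_nhds
      ((chartAt E x).open_source.mem_nhds (mem_chart_source E x))
    have hcont : ContinuousOn τ.toOpenPartialHomeomorph.symm (C' ×ˢ univ) :=
      τ.toOpenPartialHomeomorph.continuousOn_symm.mono fun y hy =>
        τ.mem_target.2 (hC's hy.1)
    -- `m` bounds the metric from below on the Euclidean unit sphere of the trivialization.
    obtain ⟨m, hm, hmin⟩ : ∃ m : ℝ, 0 < m ∧ ∀ y ∈ C', ∀ s : E, ‖s‖ = 1 →
        m ≤ (diag g.form (τ.toOpenPartialHomeomorph.symm (y, s))).re := by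
      have hK : IsCompact (C' ×ˢ Metric.sphere (0 : E) 1) := hC'c.prod (_root_.isCompact_sphere _ _)
      have hpos : ∀ y ∈ C', ∀ s : E, ‖s‖ = 1 →
          0 < (diag g.form (τ.toOpenPartialHomeomorph.symm (y, s))).re := by
        intro y hy s hs
        have hne : (τ.toOpenPartialHomeomorph.symm (y, s)).2 ≠ 0 := by
          intro h0
          have hyb : y ∈ τ.baseSet := hC's hy
          have h1 : τ (τ.toOpenPartialHomeomorph.symm (y, s)) = (y, s) :=
            τ.apply_symm_apply (τ.mem_target.2 hyb)
          have h2 : (τ.toOpenPartialHomeomorph.symm (y, s)).1 = y :=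
            τ.proj_symm_apply (τ.mem_target.2 hyb)
          have h3 : (τ (τ.toOpenPartialHomeomorph.symm (y, s))).2 = 0 := by
            have h4 := τ.linear ℂ (b := (τ.toOpenPartialHomeomorph.symm (y, s)).1)
              (by rw [h2]; exact hyb)
            have h5 := h4.map_zero
            rw [← h0] at h5
            exact h5
          rw [h1] at h3
          simp only at h3
          rw [h3, norm_zero] at hs
          exact zero_ne_one hs
        exact (Complex.pos_iff.1 (g.pos _ _ hne)).1
      rcases (C' ×ˢ Metric.sphere (0 : E) 1).eq_empty_or_nonempty with he | hne
      · refine ⟨1, one_pos, fun y hy s hs => ?_⟩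
        have : (y, s) ∈ C' ×ˢ Metric.sphere (0 : E) 1 := ⟨hy, by simpa using hs⟩
        rw [he] at this
        exact this.elim
      · obtain ⟨y₀, hy₀, hmin⟩ := hK.exists_isMinOn hne
          (Complex.continuous_re.comp_continuousOn
            (g.continuous_diag.comp_continuousOn (hcont.mono (prod_mono_right (subset_univ _)))))
        exact ⟨_, hpos y₀.1 hy₀.1 y₀.2 (by simpa using hy₀.2),
          fun y hy s hs => hmin (a := (y, s)) ⟨hy, by simpa using hs⟩⟩
    refine ⟨C', mem_nhdsWithin_of_mem_nhds hC',
      τ.toOpenPartialHomeomorph.symm '' (C' ×ˢ Metric.closedBall (0 : E) (√m)⁻¹),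
      (hC'c.prod (isCompact_closedBall _ _)).image_of_continuousOn
        (hcont.mono (prod_mono_right (subset_univ _))), ?_⟩
    intro p hp
    have hpb : p.1 ∈ τ.baseSet := hC's hp.1
    refine ⟨(p.1, (τ p).2), ⟨hp.1, ?_⟩, τ.symm_apply_mk_proj (τ.mem_source.2 hpb)⟩
    rw [mem_closedBall_zero_iff]
    -- Compare `p` with its Euclidean normalization.
    by_contra! hlt
    set s := (τ p).2 with hs
    have hs0 : 0 < ‖s‖ := lt_of_le_of_lt (inv_nonneg.2 (Real.sqrt_nonneg m)) hlt
    have h1 := hmin p.1 hp.1 (((‖s‖⁻¹ : ℝ) : ℂ) • s) (by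
      rw [norm_smul, Complex.norm_real, norm_inv, norm_norm, inv_mul_cancel₀ hs0.ne'])
    have h2 : diag g.form (τ.toOpenPartialHomeomorph.symm (p.1, ((‖s‖⁻¹ : ℝ) : ℂ) • s)) =
        ((‖s‖⁻¹ : ℝ) : ℂ) ^ 2 * diag g.form p := by
      have h3 : τ.toOpenPartialHomeomorph.symm (p.1, ((‖s‖⁻¹ : ℝ) : ℂ) • s) =
          ⟨p.1, ((‖s‖⁻¹ : ℝ) : ℂ) • p.2⟩ := by
        have h4 : τ ⟨p.1, ((‖s‖⁻¹ : ℝ) : ℂ) • p.2⟩ = (p.1, ((‖s‖⁻¹ : ℝ) : ℂ) • s) := by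
          refine Prod.ext (τ.coe_fst' hpb) ?_
          exact (τ.linear ℂ hpb).map_smul _ _
        rw [← h4]
        exact τ.symm_apply_apply (τ.mem_source.2 hpb)
      rw [h3, diag, form_smul_smul]
      rfl
    rw [h2, hp.2, mul_one, ← Complex.ofReal_pow, Complex.ofReal_re] at h1
    have h5 : ‖s‖ ^ 2 ≤ m⁻¹ := by
      rw [inv_pow] at h1
      exact (le_inv_comm₀ hm (by positivity)).1 h1
    have h6 : m⁻¹ < ‖s‖ ^ 2 := by
      have := pow_lt_pow_left₀ hlt (inv_nonneg.2 (Real.sqrt_nonneg m)) two_ne_zero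
      rwa [inv_pow, Real.sq_sqrt hm.le] at this
    linarith

/-! ### The Levi form of sums, squares and real functions -/

theorem leviAt_add {f h : E → ℂ} {z : E} (hf : ContDiffAt ℝ 2 f z) (hh : ContDiffAt ℝ 2 h z) :
    leviAt (f + h) z = leviAt f z + leviAt h z := by
  have h1 : fderiv ℝ (f + h) =ᶠ[𝓝 z] fderiv ℝ f + fderiv ℝ h := by
    filter_upwards [hf.eventually (by simp), hh.eventually (by simp)] with y hy hy'
    exact fderiv_add (hy.differentiableAt (by simp)) (hy'.differentiableAt (by simp))
  have h2 : fderiv ℝ (fderiv ℝ (f + h)) z = fderiv ℝ (fderiv ℝ f) z + fderiv ℝ (fderiv ℝ h) z := by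
    rw [h1.fderiv_eq]
    exact fderiv_add ((hf.fderiv_right (m := 1) (by norm_num)).differentiableAt (by simp))
      ((hh.fderiv_right (m := 1) (by norm_num)).differentiableAt (by simp))
  refine LinearMap.ext fun t => LinearMap.ext fun s => ?_
  simp only [leviAt, LinearMap.mk₂'ₛₗ_apply, h2, LinearMap.add_apply, add_apply]
  ring

theorem leviAt_const_mul {f : E → ℂ} {z : E} (hf : ContDiffAt ℝ 2 f z) (c : ℂ) :
    leviAt (fun y => c * f y) z = c • leviAt f z := by
  have h1 : fderiv ℝ (fun y => c * f y) =ᶠ[𝓝 z] fun y => c • fderiv ℝ f y := by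
    filter_upwards [hf.eventually (by simp)] with y hy
    exact fderiv_const_mul (hy.differentiableAt (by simp)) c
  have h2 : fderiv ℝ (fderiv ℝ (fun y => c * f y)) z = c • fderiv ℝ (fderiv ℝ f) z := by
    rw [h1.fderiv_eq]
    exact fderiv_fun_const_smul
      ((hf.fderiv_right (m := 1) (by norm_num)).differentiableAt (by simp)) c
  refine LinearMap.ext fun t => LinearMap.ext fun s => ?_
  simp only [leviAt, LinearMap.mk₂'ₛₗ_apply, h2, LinearMap.smul_apply, smul_apply, smul_eq_mul]
  ring

theorem fderiv_ofReal_comp {v : E → ℝ} {z : E} (hv : DifferentiableAt ℝ v z) :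
    fderiv ℝ (fun y => (v y : ℂ)) z = Complex.ofRealCLM.comp (fderiv ℝ v z) :=
  (Complex.ofRealCLM.hasFDerivAt.comp z hv.hasFDerivAt).fderiv

theorem fderiv_fderiv_ofReal_comp {v : E → ℝ} {z : E} (hv : ContDiffAt ℝ 2 v z) (a b : E) :
    fderiv ℝ (fderiv ℝ (fun y => (v y : ℂ))) z a b = (fderiv ℝ (fderiv ℝ v) z a b : ℂ) := by
  have h1 : fderiv ℝ (fun y => (v y : ℂ)) =ᶠ[𝓝 z]
      fun y => ContinuousLinearMap.compL ℝ E ℝ ℂ Complex.ofRealCLM (fderiv ℝ v y) := by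
    filter_upwards [hv.eventually (by simp)] with y hy
    exact fderiv_ofReal_comp (hy.differentiableAt (by simp))
  have h2 : DifferentiableAt ℝ (fderiv ℝ v) z :=
    (hv.fderiv_right (m := 1) (by norm_num)).differentiableAt (by simp)
  have h3 : HasFDerivAt
      (fun y => ContinuousLinearMap.compL ℝ E ℝ ℂ Complex.ofRealCLM (fderiv ℝ v y)) _ z :=
    (ContinuousLinearMap.hasFDerivAt _).comp z h2.hasFDerivAt
  rw [h1.fderiv_eq, h3.fderiv]
  rfl

/-- The Levi form of a real function is real on the diagonal, because the second derivative is
symmetric. -/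
theorem leviAt_ofReal_self {v : E → ℝ} {z : E} (hv : ContDiffAt ℝ 2 v z) (t : E) :
    leviAt (fun y => (v y : ℂ)) z t t =
      ((1 / 4 * (fderiv ℝ (fderiv ℝ v) z t t +
        fderiv ℝ (fderiv ℝ v) z (Complex.I • t) (Complex.I • t)) : ℝ) : ℂ) := by
  have hs := (hv.isSymmSndFDerivAt (by simp)).eq t (Complex.I • t)
  simp only [leviAt, LinearMap.mk₂'ₛₗ_apply, fderiv_fderiv_ofReal_comp hv, hs]
  push_cast
  ring

theorem leviAt_sq_self {v : E → ℝ} {z : E} (hv : ContDiffAt ℝ 2 v z) (t : E) :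
    leviAt (fun y => ((v y ^ 2 : ℝ) : ℂ)) z t t =
      2 * v z * leviAt (fun y => (v y : ℂ)) z t t +
        2 * (Complex.normSq (delAt (fun y => (v y : ℂ)) z t) : ℂ) := by
  have hd : DifferentiableAt ℝ v z := hv.differentiableAt (by simp)
  have h2 : DifferentiableAt ℝ (fderiv ℝ v) z :=
    (hv.fderiv_right (m := 1) (by norm_num)).differentiableAt (by simp)
  have h1 : fderiv ℝ (fun y => v y ^ 2) =ᶠ[𝓝 z] fun y => (2 * v y) • fderiv ℝ v y := by
    filter_upwards [hv.eventually (by simp)] with y hy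
    simpa using fderiv_fun_pow (𝕜 := ℝ) 2 (hy.differentiableAt (by simp))
  have h3 : ∀ a : E, fderiv ℝ (fderiv ℝ (fun y => v y ^ 2)) z a a =
      2 * v z * fderiv ℝ (fderiv ℝ v) z a a + 2 * fderiv ℝ v z a ^ 2 := fun a => by
    have h5 : HasFDerivAt (fun y => (2 * v y) • fderiv ℝ v y) _ z :=
      (hd.hasFDerivAt.const_mul 2).smul h2.hasFDerivAt
    rw [h1.fderiv_eq, h5.fderiv]
    simp only [add_apply, smul_apply, ContinuousLinearMap.smulRight_apply, smul_eq_mul]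
    ring
  have h4 : Complex.normSq (delAt (fun y => (v y : ℂ)) z t) =
      1 / 4 * (fderiv ℝ v z t ^ 2 + fderiv ℝ v z (Complex.I • t) ^ 2) := by
    have : delAt (fun y => (v y : ℂ)) z t = (1 / 2 : ℂ) *
        ((fderiv ℝ v z t : ℂ) - Complex.I * (fderiv ℝ v z (Complex.I • t) : ℂ)) := by
      change (1 / 2 : ℂ) * (fderiv ℝ (fun y => (v y : ℂ)) z t -
        Complex.I * fderiv ℝ (fun y => (v y : ℂ)) z (Complex.I • t)) = _
      rw [fderiv_ofReal_comp hd]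
      rfl
    rw [this, Complex.normSq_mul, Complex.normSq_apply (_ - _)]
    simp
    ring
  rw [leviAt_ofReal_self (hv.pow 2), leviAt_ofReal_self hv, h3, h3, h4]
  push_cast
  ring

theorem contDiffAt_preferred_two [IsManifold 𝓘(ℂ, E) ω M] {u : M → ℂ} {W : Set M} (hW : IsOpen W)
    (hu : ContMDiffOn 𝓘(ℝ, E) 𝓘(ℝ, ℂ) ∞ u W) {x : M} (hx : x ∈ W) :
    ContDiffAt ℝ 2 (u ∘ (chartAt E x).symm) (chartAt E x x) :=
  (contDiffAt_preferred hW hu hx).of_le (WithTop.coe_le_coe.2 (le_top : (2 : ℕ∞) ≤ ⊤))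

theorem contMDiffOn_ofReal {v : M → ℝ} {W : Set M}
    (hv : ContMDiffOn 𝓘(ℝ, E) 𝓘(ℝ, ℝ) ∞ v W) :
    ContMDiffOn 𝓘(ℝ, E) 𝓘(ℝ, ℂ) ∞ (fun x => (v x : ℂ)) W :=
  Complex.ofRealCLM.contMDiff.comp_contMDiffOn hv

theorem contDiffAt_preferred_real [IsManifold 𝓘(ℂ, E) ω M] {v : M → ℝ} {W : Set M}
    (hW : IsOpen W) (hv : ContMDiffOn 𝓘(ℝ, E) 𝓘(ℝ, ℝ) ∞ v W) {x : M} (hx : x ∈ W) :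
    ContDiffAt ℝ 2 (v ∘ (chartAt E x).symm) (chartAt E x x) :=
  Complex.reCLM.contDiff.contDiffAt.comp _
    (contDiffAt_preferred_two hW (contMDiffOn_ofReal hv) hx)

theorem ddbar_congr {u v : M → ℂ} {x : M} (h : u =ᶠ[𝓝 x] v) : ddbar E u x = ddbar E v x := by
  have h1 : Tendsto (chartAt E x).symm (𝓝 (chartAt E x x)) (𝓝 x) := by
    have := (chartAt E x).continuousAt_symm (mem_chart_target E x)
    rwa [ContinuousAt, (chartAt E x).left_inv (mem_chart_source E x)] at this
  have h2 : u ∘ (chartAt E x).symm =ᶠ[𝓝 (chartAt E x x)] v ∘ (chartAt E x).symm :=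
    h1.eventually h
  refine LinearMap.ext fun t => LinearMap.ext fun s => ?_
  simp only [ddbar, leviAt, h2.fderiv.fderiv_eq]

theorem ddbar_add [IsManifold 𝓘(ℂ, E) ω M] {u v : M → ℂ} {W : Set M} (hW : IsOpen W)
    (hu : ContMDiffOn 𝓘(ℝ, E) 𝓘(ℝ, ℂ) ∞ u W) (hv : ContMDiffOn 𝓘(ℝ, E) 𝓘(ℝ, ℂ) ∞ v W) {x : M}
    (hx : x ∈ W) : ddbar E (u + v) x = ddbar E u x + ddbar E v x :=
  leviAt_add (contDiffAt_preferred_two hW hu hx) (contDiffAt_preferred_two hW hv hx)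

theorem ddbar_const_mul [IsManifold 𝓘(ℂ, E) ω M] {u : M → ℂ} {W : Set M} (hW : IsOpen W)
    (hu : ContMDiffOn 𝓘(ℝ, E) 𝓘(ℝ, ℂ) ∞ u W) {x : M} (hx : x ∈ W) (c : ℂ) :
    ddbar E (fun y => c * u y) x = c • ddbar E u x :=
  leviAt_const_mul (contDiffAt_preferred_two hW hu hx) c

theorem ddbar_ofReal_self_im [IsManifold 𝓘(ℂ, E) ω M] {v : M → ℝ} {W : Set M} (hW : IsOpen W)
    (hv : ContMDiffOn 𝓘(ℝ, E) 𝓘(ℝ, ℝ) ∞ v W) {x : M} (hx : x ∈ W)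
    (t : TangentSpace 𝓘(ℂ, E) x) : (ddbar E (fun y => (v y : ℂ)) x t t).im = 0 :=
  (congrArg Complex.im
    (leviAt_ofReal_self (contDiffAt_preferred_real hW hv hx) t)).trans (Complex.ofReal_im _)

/-- `i∂∂̄(v²) = 2 v i∂∂̄v + 2 i ∂v ∧ ∂̄v`. -/
theorem ddbar_sq_self [IsManifold 𝓘(ℂ, E) ω M] {v : M → ℝ} {W : Set M} (hW : IsOpen W)
    (hv : ContMDiffOn 𝓘(ℝ, E) 𝓘(ℝ, ℝ) ∞ v W) {x : M} (hx : x ∈ W)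
    (t : TangentSpace 𝓘(ℂ, E) x) :
    ddbar E (fun y => ((v y ^ 2 : ℝ) : ℂ)) x t t =
      2 * v x * ddbar E (fun y => (v y : ℂ)) x t t +
        2 * (Complex.normSq (del E (fun y => (v y : ℂ)) x t) : ℂ) := by
  have h := leviAt_sq_self (contDiffAt_preferred_real hW hv hx) t
  rw [Function.comp_apply, (chartAt E x).left_inv (mem_chart_source E x)] at h
  exact h

/-! ### Positivity on compact sets -/

/-- A penalty argument: if `b ≥ 0` on a compact set, and `a > 0` at the zeros of `b`, then
`a + A b > 0` for some constant `A`. -/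
theorem exists_pos_add_mul {X : Type*} [TopologicalSpace X] {s : Set X} (hs : IsCompact s)
    (hsc : IsClosed s) {a b : X → ℝ} (ha : ContinuousOn a s) (hb : ContinuousOn b s)
    (hb0 : ∀ x ∈ s, 0 ≤ b x) (hab : ∀ x ∈ s, b x = 0 → 0 < a x) :
    ∃ A : ℝ, ∀ x ∈ s, 0 < a x + A * b x := by
  have hs' : IsCompact (s ∩ a ⁻¹' Iic 0) :=
    hs.of_isClosed_subset (ha.preimage_isClosed_of_isClosed hsc isClosed_Iic) inter_subset_left
  have hpos : ∀ x ∈ s ∩ a ⁻¹' Iic 0, 0 < b x := fun x hx =>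
    (hb0 x hx.1).lt_of_ne fun h => (hab x hx.1 h.symm).not_ge hx.2
  obtain ⟨R, hR⟩ := hs'.bddAbove_image (f := fun x => -a x / b x)
    ((ha.mono inter_subset_left).neg.div (hb.mono inter_subset_left) fun x hx => (hpos x hx).ne')
  refine ⟨|R| + 1, fun x hx => ?_⟩
  by_cases hax : a x ≤ 0
  · have hbx := hpos x ⟨hx, hax⟩
    have h1 : -a x / b x ≤ R := hR ⟨x, ⟨hx, hax⟩, rfl⟩
    have h2 : -a x < (|R| + 1) * b x :=
      (div_lt_iff₀ hbx).1 (h1.trans_lt ((le_abs_self R).trans_lt (lt_add_one _)))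
    linarith
  · have := mul_nonneg (add_nonneg (abs_nonneg R) zero_le_one) (hb0 x hx)
    linarith [not_le.1 hax]

theorem diag_pos_of_sphere (g : HermitianMetric E M) {φ : Form11 E M} {C : Set M}
    (h : ∀ p ∈ g.sphere C, 0 < diag φ p) {x : M} (hx : x ∈ C) {t : TangentSpace 𝓘(ℂ, E) x}
    (ht : t ≠ 0) : 0 < φ x t t := by
  obtain ⟨c, s, hc, rfl, hs⟩ := g.exists_mem_sphere hx ht
  rw [form_smul_smul, ← Complex.ofReal_pow]
  exact mul_pos (Complex.zero_lt_real.2 (pow_pos hc 2)) (h _ hs)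

/-- A smooth form that is positive definite at the points of a compact set dominates there a
positive multiple of the metric. -/
theorem exists_mul_metric_le [FiniteDimensional ℂ E] [IsManifold 𝓘(ℂ, E) ω M] [T2Space M]
    (g : HermitianMetric E M) {φ : Form11 E M} {W C : Set M} (hW : IsOpen W)
    (hφ : IsSmoothForm φ W) (hC : IsCompact C) (hCW : C ⊆ W)
    (hpos : ∀ x ∈ C, ∀ t : TangentSpace 𝓘(ℂ, E) x, t ≠ 0 → 0 < φ x t t) :
    ∃ c : ℝ, 0 < c ∧ ∀ x ∈ C, ∀ t : TangentSpace 𝓘(ℂ, E) x, (c : ℂ) * g.form x t t ≤ φ x t t := by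
  obtain ⟨c, hc, hle⟩ : ∃ c : ℝ, 0 < c ∧ ∀ p ∈ g.sphere C, c ≤ (diag φ p).re := by
    rcases (g.sphere C).eq_empty_or_nonempty with he | hne
    · exact ⟨1, one_pos, fun p hp => by rw [he] at hp; exact hp.elim⟩
    · obtain ⟨p, hp, hmin⟩ := (g.isCompact_sphere hC).exists_isMinOn hne
        (Complex.continuous_re.comp_continuousOn
          ((continuousOn_diag hW hφ).mono fun p hp => hCW hp.1))
      exact ⟨_, (Complex.pos_iff.1 (hpos _ hp.1 _ (g.ne_zero_of_mem_sphere hp))).1,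
        fun q hq => hmin hq⟩
  refine ⟨c, hc, fun x hx t => ?_⟩
  by_cases ht : t = 0
  · simp [ht]
  · obtain ⟨d, s, hd, rfl, hs⟩ := g.exists_mem_sphere hx ht
    have h1 : (c : ℂ) ≤ φ x s s := by
      refine Complex.le_def.2 ⟨hle _ hs, ?_⟩
      rw [Complex.ofReal_im]
      exact (Complex.pos_iff.1 (hpos x hx s (g.ne_zero_of_mem_sphere hs))).2
    have h2 : g.form x s s = 1 := hs.2
    rw [form_smul_smul, form_smul_smul, h2, mul_one, mul_comm, ← Complex.ofReal_pow]
    exact mul_le_mul_of_nonneg_left h1 (Complex.zero_le_real.2 (sq_nonneg d))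

/-- A smooth function whose Levi form is positive definite at the points of a compact set is
strictly plurisubharmonic near that set. -/
theorem exists_isSmoothStrictlyPshOn [FiniteDimensional ℂ E] [IsManifold 𝓘(ℂ, E) ω M] [T2Space M]
    (g : HermitianMetric E M) {w : M → ℝ} {W K : Set M} (hW : IsOpen W)
    (hw : ContMDiffOn 𝓘(ℝ, E) 𝓘(ℝ, ℝ) ∞ w W) (hK : IsCompact K) (hKW : K ⊆ W)
    (hpos : ∀ p ∈ g.sphere K, 0 < (diag (ddbar E fun x => (w x : ℂ)) p).re) :
    ∃ V : Set M, IsOpen V ∧ K ⊆ V ∧ IsSmoothStrictlyPshOn E w V := by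
  have : LocallyCompactSpace M := ChartedSpace.locallyCompactSpace E M
  obtain ⟨C, hC, hKC, hCW⟩ := exists_compact_between hK hW hKW
  set ψ : TangentBundle 𝓘(ℂ, E) M → ℝ := fun p => (diag (ddbar E fun x => (w x : ℂ)) p).re
  have hψ : ContinuousOn ψ (g.sphere C) := Complex.continuous_re.comp_continuousOn
    ((continuousOn_diag hW (ddbar_smooth hW (contMDiffOn_ofReal hw))).mono fun p hp => hCW hp.1)
  have hbad : IsCompact (g.sphere C ∩ ψ ⁻¹' Iic 0) :=
    (g.isCompact_sphere hC).of_isClosed_subset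
      (hψ.preimage_isClosed_of_isClosed (g.isClosed_sphere hC.isClosed) isClosed_Iic)
      inter_subset_left
  have hproj := hbad.image (FiberBundle.continuous_proj E (TangentSpace 𝓘(ℂ, E)))
  refine ⟨interior C ∩ (_ '' (g.sphere C ∩ ψ ⁻¹' Iic 0))ᶜ,
    isOpen_interior.inter hproj.isClosed.isOpen_compl, fun x hx => ⟨hKC hx, ?_⟩,
    hw.mono fun x hx => hCW (interior_subset hx.1), fun x hx t ht => ?_⟩
  · rintro ⟨p, ⟨hp1, hp2⟩, rfl⟩
    exact (hpos p ⟨hx, hp1.2⟩).not_ge hp2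
  · refine diag_pos_of_sphere g (C := {x}) (fun p hp => ?_) (mem_singleton x) ht
    have hpx : p.1 = x := hp.1
    refine Complex.pos_iff.2 ⟨not_le.1 fun h => hx.2 ?_, ?_⟩
    · exact ⟨p, ⟨⟨hpx ▸ interior_subset hx.1, hp.2⟩, h⟩, hpx⟩
    · exact (ddbar_ofReal_self_im hW hw (hpx ▸ hCW (interior_subset hx.1)) p.2).symm

/-! ### A strictly plurisubharmonic function excludes Levi currents -/

theorem Current11.IsSupportedIn.congr {T : Current11 E M} {F : Set M} (hT : T.IsSupportedIn F)
    {φ ψ : TestForm11 E M}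
    (h : ∀ᶠ x in 𝓝ˢ F, (φ : Form11 E M) x = (ψ : Form11 E M) x) : T.toFun φ = T.toFun ψ := by
  rw [← sub_eq_zero, ← map_sub]
  refine hT _ ?_
  obtain ⟨N, hN, hFN, hNh⟩ := mem_nhdsSet_iff_exists.1 h
  refine disjoint_compl_left.mono ?_ hFN
  refine closure_minimal (fun x hx hxN => hx ?_) hN.isClosed_compl
  have : (φ : Form11 E M) x = (ψ : Form11 E M) x := hNh hxN
  simp [this]

theorem exists_cutoff_function [FiniteDimensional ℂ E] [IsManifold 𝓘(ℂ, E) ω M] [T2Space M]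
    [SecondCountableTopology M] {K V : Set M} (hK : IsCompact K) (hV : IsOpen V) (hKV : K ⊆ V) :
    ∃ χ : M → ℝ, ContMDiff 𝓘(ℝ, E) 𝓘(ℝ, ℝ) ∞ χ ∧ HasCompactSupport χ ∧ tsupport χ ⊆ V ∧
      (∀ᶠ x in 𝓝ˢ K, χ x = 1) ∧ ∀ x, 0 ≤ χ x := by
  have : LocallyCompactSpace M := ChartedSpace.locallyCompactSpace E M
  have : IsManifold 𝓘(ℝ, E) ∞ M := isManifold_real
  have : FiniteDimensional ℝ E := FiniteDimensional.complexToReal E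
  obtain ⟨C, hC, hKC, hCV⟩ := exists_compact_between hK hV hKV
  obtain ⟨f, hf1, hf0, hf⟩ := exists_contMDiffMap_one_nhds_of_subset_interior (n := (⊤ : ℕ∞))
    𝓘(ℝ, E) hK.isClosed hKC
  have hs : tsupport f ⊆ C :=
    closure_minimal (fun x hx => by_contra fun h => hx (hf0 x h)) hC.isClosed
  exact ⟨f, f.contMDiff, hC.of_isClosed_subset (isClosed_tsupport _) hs, hs.trans hCV, hf1,
    fun x => (hf x).1⟩

theorem tsupport_ofReal_comp {X : Type*} [TopologicalSpace X] (χ : X → ℝ) :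
    tsupport (fun x => (χ x : ℂ)) = tsupport χ := by
  have : Function.support (fun x => (χ x : ℂ)) = Function.support χ := by
    ext x
    simp
  rw [tsupport, this, tsupport]

theorem IsTestFun.ofReal {χ : M → ℝ} {W : Set M} (h1 : ContMDiff 𝓘(ℝ, E) 𝓘(ℝ, ℝ) ∞ χ)
    (h2 : HasCompactSupport χ) (h3 : tsupport χ ⊆ W) : IsTestFun E W fun x => (χ x : ℂ) :=
  ⟨contMDiffOn_univ.1 (contMDiffOn_ofReal h1.contMDiffOn),
    h2.comp_left (g := fun y : ℝ => (y : ℂ)) Complex.ofReal_zero,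
    (tsupport_ofReal_comp χ).trans_subset h3⟩

/-- If `χ` is a cutoff function, then `χ (i∂∂̄u - c ω)` is a positive form for small `c > 0`, while
a Levi current would take the value `-c` on it, since near the boundary this form is
`i∂∂̄(χ u) - c ω`. -/
theorem not_isLeviCurrent_of_strictlyPsh [FiniteDimensional ℂ E] [IsManifold 𝓘(ℂ, E) ω M]
    [T2Space M] [SecondCountableTopology M] (g : HermitianMetric E M) {U : Set M}
    (hU : IsCompact (closure U)) (ρ : DefiningFunction E U) {V : Set M} {u : M → ℝ}
    (hV : IsOpen V) (hUV : frontier U ⊆ V) (hu : IsSmoothStrictlyPshOn E u V)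
    (T : Current11 E M) : ¬ IsLeviCurrent g ρ T := by
  intro hT
  have hK : IsCompact (frontier U) := hU.of_isClosed_subset isClosed_frontier frontier_subset_closure
  obtain ⟨χ, hχs, hχc, hχV, hχ1, hχ0⟩ := exists_cutoff_function (E := E) hK hV hUV
  have hχ : IsTestFun E V fun x => (χ x : ℂ) := .ofReal hχs hχc hχV
  have hχ' : IsTestFun E univ fun x => (χ x : ℂ) := .ofReal hχs hχc (subset_univ _)
  have huC := contMDiffOn_ofReal hu.smooth
  have hφ : IsSmoothForm (ddbar E fun x => (u x : ℂ)) V := ddbar_smooth hV huC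
  obtain ⟨c, hc, hle⟩ := exists_mul_metric_le g hV hφ hχc hχV fun x hx => hu.pos x (hχV hx)
  have hw : IsTestFun E univ fun x => ((χ x * u x : ℝ) : ℂ) := by
    have hsub : tsupport (fun x => χ x * u x) ⊆ tsupport χ := tsupport_mul_subset_left
    refine .ofReal (contMDiff_of_tsupport fun x hx => ?_) hχc.mul_right (subset_univ _)
    exact (hχs x).mul (hu.smooth.contMDiffAt (hV.mem_nhds (hχV (hsub hx))))
  have h1 : T.toFun (cutoff hV _ hφ _ hχ) = T.toFun (ddbarTest _ hw) := by
    refine hT.supported.congr ?_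
    filter_upwards [hχ1.eventually_nhdsSet] with x hx
    have hx1 : (χ x : ℂ) = 1 := by rw [hx.self_of_nhds, Complex.ofReal_one]
    have hx2 : (fun y => ((χ y * u y : ℝ) : ℂ)) =ᶠ[𝓝 x] fun y => (u y : ℂ) := by
      filter_upwards [hx] with y hy
      rw [hy, one_mul]
    change (χ x : ℂ) • ddbar E (fun y => (u y : ℂ)) x = ddbar E _ x
    rw [hx1, one_smul, ddbar_congr hx2]
  have h2 := hT.mass _ hχ' (by filter_upwards [hχ1] with x hx; simp [hx])
  have hlin : ∀ φ ψ : TestForm11 E M,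
      T.toFun (φ - (c : ℂ) • ψ) = T.toFun φ - (c : ℂ) * T.toFun ψ := fun φ ψ =>
    (T.toFun.map_sub φ _).trans (congrArg (T.toFun φ - ·) (T.toFun.map_smul _ ψ))
  have h3 := hT.positive (cutoff hV _ hφ _ hχ - (c : ℂ) • cutoff isOpen_univ g.form g.smooth _ hχ')
    fun x t => by
      change 0 ≤ (χ x : ℂ) * ddbar E (fun x => (u x : ℂ)) x t t -
        (c : ℂ) * ((χ x : ℂ) * g.form x t t)
      rw [mul_left_comm, ← mul_sub]
      by_cases hx : x ∈ tsupport χ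
      · exact mul_nonneg (Complex.zero_le_real.2 (hχ0 x)) (sub_nonneg.2 (hle x hx t))
      · simp [image_eq_zero_of_notMem_tsupport hx]
  have h4 := h3.trans_eq (hlin _ _)
  rw [h1, h2, hT.ddbar_closed _ hw, mul_one, zero_sub, ← Complex.ofReal_neg,
    Complex.zero_le_real] at h4
  linarith

/-! ### Currents from functionals on continuous functions -/

/-- The restriction of `(x, t) ↦ φ x t t` to a subset `N` of the tangent bundle, as a linear
function of the test form `φ`. -/
def restrictDiag [FiniteDimensional ℂ E] [IsManifold 𝓘(ℂ, E) ω M]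
    (N : Set (TangentBundle 𝓘(ℂ, E) M)) : TestForm11 E M →ₗ[ℂ] C(N, ℂ) where
  toFun φ := ⟨fun p => diag (φ : Form11 E M) p,
    ((continuousOn_diag isOpen_univ φ.2.1).mono fun _ _ => mem_univ _).domRestrict⟩
  map_add' _ _ := rfl
  map_smul' _ _ := rfl

/-- The current `φ ↦ Λ ((x, t) ↦ φ x t t)` associated to a continuous linear functional `Λ` on the
continuous functions on a compact subset of the tangent bundle. -/
def Current11.ofFunctional [FiniteDimensional ℂ E] [IsManifold 𝓘(ℂ, E) ω M]
    (N : Set (TangentBundle 𝓘(ℂ, E) M)) [CompactSpace N] (Λ : C(N, ℂ) →L[ℂ] ℂ) :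
    Current11 E M where
  toFun := Λ.toLinearMap ∘ₗ restrictDiag N
  continuous φ hφ := by
    have h : Tendsto (fun j => restrictDiag N (φ j)) atTop (𝓝 0) := by
      rw [ContinuousMap.tendsto_iff_tendstoUniformly,
        ← tendstoLocallyUniformly_iff_tendstoUniformly_of_compactSpace]
      exact hφ.tendstoLocallyUniformly_diag.comp Subtype.val continuous_subtype_val
    have h2 := (Λ.continuous.tendsto 0).comp h
    rwa [map_zero] at h2

/-- The complex linear extension of a real linear functional on real continuous functions. -/
def complexify {X : Type*} [TopologicalSpace X] [CompactSpace X] (Λ : C(X, ℝ) →L[ℝ] ℝ) :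
    C(X, ℂ) →L[ℂ] ℂ where
  toFun F := (Λ (Complex.reCLM.compLeftContinuous ℝ X F) : ℂ) +
    Complex.I * (Λ (Complex.imCLM.compLeftContinuous ℝ X F) : ℂ)
  map_add' F G := by
    simp only [map_add, Complex.ofReal_add]
    ring
  map_smul' c F := by
    have h1 : Complex.reCLM.compLeftContinuous ℝ X (c • F) =
        c.re • Complex.reCLM.compLeftContinuous ℝ X F -
          c.im • Complex.imCLM.compLeftContinuous ℝ X F := by
      ext x
      simp
    have h2 : Complex.imCLM.compLeftContinuous ℝ X (c • F) =
        c.re • Complex.imCLM.compLeftContinuous ℝ X F +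
          c.im • Complex.reCLM.compLeftContinuous ℝ X F := by
      ext x
      simp
    rw [h1, h2, map_sub, map_add, map_smul, map_smul, map_smul, map_smul, RingHom.id_apply,
      smul_eq_mul, smul_eq_mul, smul_eq_mul, smul_eq_mul, smul_eq_mul]
    conv_rhs => rw [← Complex.re_add_im c]
    push_cast
    linear_combination (-(c.im : ℂ) * Λ (Complex.imCLM.compLeftContinuous ℝ X F)) * Complex.I_sq
  cont := by fun_prop

/-- Hahn-Banach: a subspace of `C(X, ℝ)` without positive functions is annihilated by a normalized
positive functional. -/
theorem exists_positive_functional {X : Type*} [TopologicalSpace X] [CompactSpace X]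
    (S : Submodule ℝ C(X, ℝ)) (hS : ∀ f ∈ S, ¬ ∀ x, 0 < f x) :
    ∃ Λ : C(X, ℝ) →L[ℝ] ℝ, (∀ f, (∀ x, 0 ≤ f x) → 0 ≤ Λ f) ∧ Λ 1 = 1 ∧ ∀ f ∈ S, Λ f = 0 := by
  let P : Set C(X, ℝ) := {f | MapsTo f univ (Ioi 0)}
  have hP : IsOpen P := ContinuousMap.isOpen_setOfPred_mapsTo isCompact_univ isOpen_Ioi
  have hPc : Convex ℝ P := by
    intro f hf h hh a b ha hb hab x _
    have h1 : (0 : ℝ) < f x := hf (mem_univ x)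
    have h2 : (0 : ℝ) < h x := hh (mem_univ x)
    change 0 < a * f x + b * h x
    rcases ha.eq_or_lt with rfl | ha
    · rw [zero_add] at hab
      simpa [hab] using h2
    · exact add_pos_of_pos_of_nonneg (mul_pos ha h1) (mul_nonneg hb h2.le)
  obtain ⟨L, c, hL, hc⟩ := geometric_hahn_banach_open hPc hP S.convex
    (disjoint_left.2 fun f hf hfS => hS f hfS fun x => hf (mem_univ x))
  have hc0 : c ≤ 0 := by simpa using hc 0 S.zero_mem
  have hLS : ∀ f ∈ S, L f = 0 := by
    -- A linear functional that is bounded below on a subspace vanishes there.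
    intro f hf
    by_contra hne
    have h1 := hc (((c - 1) / L f) • f) (S.smul_mem _ hf)
    rw [map_smul, smul_eq_mul, div_mul_cancel₀ _ hne] at h1
    linarith
  have hL1 : L 1 < 0 := (hL 1 fun x _ => mem_Ioi.2 one_pos).trans_le hc0
  refine ⟨(L 1)⁻¹ • L, fun f hf => ?_, inv_mul_cancel₀ hL1.ne, fun f hf => ?_⟩
  · have h1 : L f ≤ 0 := by
      refine le_of_forall_pos_le_add fun ε hε => ?_
      have hd : 0 < ε / -L 1 := div_pos hε (neg_pos.2 hL1)
      have h2 := hL (f + (ε / -L 1) • (1 : C(X, ℝ))) fun x _ => by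
        have h0 := hf x
        have : (0 : ℝ) < f x + (ε / -L 1) * 1 := by linarith
        exact this
      rw [map_add, map_smul, smul_eq_mul, div_neg, neg_mul, div_mul_cancel₀ _ hL1.ne] at h2
      linarith
    exact mul_nonneg_of_nonpos_of_nonpos (inv_nonpos.2 hL1.le) h1
  · change (L 1)⁻¹ * L f = 0
    rw [hLS f hf, mul_zero]

/-! ### The duality argument -/

theorem IsTestFun.re {u : M → ℂ} {W : Set M} (hu : IsTestFun E W u) :
    IsTestFun E W fun x => ((u x).re : ℂ) :=
  ⟨(Complex.ofRealCLM.comp Complex.reCLM).contMDiff.comp hu.smooth,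
    hu.compact.comp_left (g := fun z : ℂ => (z.re : ℂ)) (by simp),
    (closure_mono fun x (hx : _ ≠ _) (h : u x = 0) => hx (by simp [h])).trans hu.subset⟩

theorem IsTestFun.im {u : M → ℂ} {W : Set M} (hu : IsTestFun E W u) :
    IsTestFun E W fun x => ((u x).im : ℂ) :=
  ⟨(Complex.ofRealCLM.comp Complex.imCLM).contMDiff.comp hu.smooth,
    hu.compact.comp_left (g := fun z : ℂ => (z.im : ℂ)) (by simp),
    (closure_mono fun x (hx : _ ≠ _) (h : u x = 0) => hx (by simp [h])).trans hu.subset⟩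

theorem IsTestFun.contMDiffOn_real {v : M → ℝ} {W : Set M}
    (hv : IsTestFun E W fun x => (v x : ℂ)) : ContMDiffOn 𝓘(ℝ, E) 𝓘(ℝ, ℝ) ∞ v univ :=
  (Complex.reCLM.contMDiff.comp hv.smooth).contMDiffOn

/-- The Levi forms of real test functions, as continuous functions on a subset `N` of the tangent
bundle. -/
def leviFunctions [FiniteDimensional ℂ E] [IsManifold 𝓘(ℂ, E) ω M]
    (N : Set (TangentBundle 𝓘(ℂ, E) M)) : Submodule ℝ C(N, ℝ) where
  carrier := {f | ∃ v : M → ℝ, IsTestFun E univ (fun x => (v x : ℂ)) ∧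
    ∀ p : N, (f p : ℂ) = diag (ddbar E fun x => (v x : ℂ)) p}
  zero_mem' := by
    refine ⟨fun _ => 0, ⟨contMDiff_const, HasCompactSupport.zero, subset_univ _⟩, fun p => ?_⟩
    have h := ddbar_const_mul (E := E) (u := fun _ : M => 0) isOpen_univ contMDiffOn_const
      (mem_univ p.1.1) 0
    rw [zero_smul] at h
    simp only [mul_zero] at h
    simp [diag, h]
  add_mem' := by
    rintro f f' ⟨v, hv, hf⟩ ⟨v', hv', hf'⟩
    have he : (fun x => ((v x + v' x : ℝ) : ℂ)) = (fun x => (v x : ℂ)) + fun x => (v' x : ℂ) := by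
      ext x
      simp
    refine ⟨fun x => v x + v' x, ?_, fun p => ?_⟩
    · rw [he]
      exact ⟨hv.smooth.add hv'.smooth, hv.compact.add hv'.compact, subset_univ _⟩
    · rw [he, diag, ddbar_add isOpen_univ hv.smooth.contMDiffOn hv'.smooth.contMDiffOn
        (mem_univ p.1.1), ContinuousMap.add_apply, Complex.ofReal_add, hf, hf']
      rfl
  smul_mem' := by
    rintro c f ⟨v, hv, hf⟩
    have he : (fun x => ((c * v x : ℝ) : ℂ)) = fun x => (c : ℂ) * (v x : ℂ) := by
      ext x
      simp
    refine ⟨fun x => c * v x, ?_, fun p => ?_⟩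
    · exact .ofReal (contMDiffOn_univ.1 (contMDiffOn_const.mul hv.contMDiffOn_real))
        (HasCompactSupport.mul_left (by
          have := hv.compact
          rwa [HasCompactSupport, tsupport_ofReal_comp] at this)) (subset_univ _)
    · rw [he, diag, ddbar_const_mul isOpen_univ hv.smooth.contMDiffOn (mem_univ p.1.1),
        ContinuousMap.smul_apply, smul_eq_mul, Complex.ofReal_mul, hf]
      rfl

/-- The Levi form of a complex test function is `(i∂∂̄ Re u) + i (i∂∂̄ Im u)`, and both summands are
real on the diagonal. -/
theorem diag_ddbar_eq [IsManifold 𝓘(ℂ, E) ω M] {u : M → ℂ} (hu : IsTestFun E univ u)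
    (p : TangentBundle 𝓘(ℂ, E) M) :
    (((diag (ddbar E u) p).re : ℂ) = diag (ddbar E fun x => ((u x).re : ℂ)) p) ∧
      (((diag (ddbar E u) p).im : ℂ) = diag (ddbar E fun x => ((u x).im : ℂ)) p) := by
  have hi : ContMDiffOn 𝓘(ℝ, E) 𝓘(ℝ, ℂ) ∞ (fun x => Complex.I * ((u x).im : ℂ)) univ :=
    ((ContinuousLinearMap.mul ℝ ℂ Complex.I).contMDiff.comp hu.im.smooth).contMDiffOn
  have h1 : ddbar E u p.1 = ddbar E (fun x => ((u x).re : ℂ)) p.1 +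
      Complex.I • ddbar E (fun x => ((u x).im : ℂ)) p.1 := by
    rw [← ddbar_const_mul isOpen_univ hu.im.smooth.contMDiffOn (mem_univ p.1),
      ← ddbar_add isOpen_univ hu.re.smooth.contMDiffOn hi (mem_univ p.1)]
    congr 1
    ext x
    simp [mul_comm Complex.I]
  have h2 := ddbar_ofReal_self_im isOpen_univ hu.re.contMDiffOn_real (mem_univ p.1) p.2
  have h3 := ddbar_ofReal_self_im isOpen_univ hu.im.contMDiffOn_real (mem_univ p.1) p.2
  have h4 : diag (ddbar E u) p = diag (ddbar E fun x => ((u x).re : ℂ)) p +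
      Complex.I * diag (ddbar E fun x => ((u x).im : ℂ)) p := by
    rw [diag, h1]
    rfl
  rw [h4]
  change (diag (ddbar E fun x => ((u x).re : ℂ)) p).im = 0 at h2
  change (diag (ddbar E fun x => ((u x).im : ℂ)) p).im = 0 at h3
  constructor <;> apply Complex.ext <;> simp [h2, h3]

theorem DefiningFunction.r_eq_zero {U : Set M} (ρ : DefiningFunction E U) {x : M}
    (hx : x ∈ frontier U) : ρ.r x = 0 := by
  have hxn : x ∈ ρ.nhd := ρ.closure_subset (frontier_subset_closure hx)
  have hc : ContinuousAt ρ.r x := ρ.smooth.continuousOn.continuousAt (ρ.isOpen_nhd.mem_nhds hxn)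
  refine le_antisymm ?_ (not_lt.1 fun hlt => ?_)
  · refine hc.continuousWithinAt.closure_le (frontier_subset_closure hx)
      continuousWithinAt_const fun y hy => ?_
    rw [ρ.eq] at hy
    exact hy.2.le
  · have hU : U ∈ 𝓝 x := by
      rw [ρ.eq]
      exact (ρ.isOpen_nhd.eventually_mem hxn).and (hc.eventually (gt_mem_nhds hlt))
    exact hx.2 (mem_interior_iff_mem_nhds.2 hU)

/-- The set of unit vectors, tangent to `M` at points of `∂U`, that are complex tangent to `∂U` and
null for the Levi form of the defining function. The condition `∂r(t) = 0` is expressed by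
`i∂∂̄(r²)(t, t) = 2 |∂r(t)|²`, which holds where `r = 0`. -/
def DefiningFunction.nullVectors (g : HermitianMetric E M) {U : Set M}
    (ρ : DefiningFunction E U) : Set (TangentBundle 𝓘(ℂ, E) M) :=
  {p ∈ g.sphere (frontier U) | (diag (ddbar E fun x => ((ρ.r x ^ 2 : ℝ) : ℂ)) p).re = 0 ∧
    (diag (ddbar E ρ.rC) p).re = 0}

theorem DefiningFunction.smooth_sq {U : Set M} (ρ : DefiningFunction E U) :
    ContMDiffOn 𝓘(ℝ, E) 𝓘(ℝ, ℝ) ∞ (fun x => ρ.r x ^ 2) ρ.nhd :=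
  ρ.smooth.pow 2

theorem DefiningFunction.diag_ddbar_sq [IsManifold 𝓘(ℂ, E) ω M] {U : Set M}
    (ρ : DefiningFunction E U) {p : TangentBundle 𝓘(ℂ, E) M} (hp : p.1 ∈ frontier U) :
    (diag (ddbar E fun x => ((ρ.r x ^ 2 : ℝ) : ℂ)) p).re =
      2 * Complex.normSq (del E ρ.rC p.1 p.2) := by
  have h := ddbar_sq_self ρ.isOpen_nhd ρ.smooth
    (ρ.closure_subset (frontier_subset_closure hp)) p.2
  rw [ρ.r_eq_zero hp, Complex.ofReal_zero, mul_zero, zero_mul, zero_add] at h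
  rw [diag, h]
  simp only [Complex.mul_re, Complex.re_ofNat, Complex.im_ofNat, zero_mul, sub_zero,
    Complex.ofReal_re]
  rfl

section NullVectors

variable [FiniteDimensional ℂ E] [IsManifold 𝓘(ℂ, E) ω M]

theorem continuousOn_diag_ddbar {v : M → ℝ} {W : Set M} (hW : IsOpen W)
    (hv : ContMDiffOn 𝓘(ℝ, E) 𝓘(ℝ, ℝ) ∞ v W) :
    ContinuousOn (fun p => (diag (ddbar E fun x => (v x : ℂ)) p).re) {p | p.1 ∈ W} :=
  Complex.continuous_re.comp_continuousOn
    (continuousOn_diag hW (ddbar_smooth hW (contMDiffOn_ofReal hv)))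

theorem DefiningFunction.isCompact_nullVectors [T2Space M] (g : HermitianMetric E M) {U : Set M}
    (hK : IsCompact (frontier U)) (ρ : DefiningFunction E U) :
    IsCompact (ρ.nullVectors g) := by
  have hsub : g.sphere (frontier U) ⊆ {p | p.1 ∈ ρ.nhd} := fun p hp =>
    ρ.closure_subset (frontier_subset_closure hp.1)
  have h1 := (continuousOn_diag_ddbar ρ.isOpen_nhd ρ.smooth_sq).mono hsub
  have h2 := (continuousOn_diag_ddbar ρ.isOpen_nhd ρ.smooth).mono hsub
  have h : ρ.nullVectors g = g.sphere (frontier U) ∩ (fun p =>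
      ((diag (ddbar E fun x => ((ρ.r x ^ 2 : ℝ) : ℂ)) p).re,
        (diag (ddbar E fun x => (ρ.r x : ℂ)) p).re)) ⁻¹' {((0 : ℝ), (0 : ℝ))} := by
    ext p
    simp only [DefiningFunction.nullVectors, mem_inter_iff, mem_preimage, mem_singleton_iff,
      Prod.mk.injEq]
    rfl
  rw [h]
  exact (g.isCompact_sphere hK).of_isClosed_subset
    ((h1.prodMk h2).preimage_isClosed_of_isClosed (g.isClosed_sphere isClosed_frontier)
      isClosed_singleton) inter_subset_left

/-- A normalized positive functional on the continuous functions on the null vectors that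
annihilates the Levi forms of test functions defines a Levi current. -/
theorem DefiningFunction.isLeviCurrent_ofFunctional [T2Space M] (g : HermitianMetric E M)
    {U : Set M} (ρ : DefiningFunction E U) {N : Set (TangentBundle 𝓘(ℂ, E) M)} [CompactSpace N]
    (hN : N ⊆ ρ.nullVectors g) {Λ : C(N, ℝ) →L[ℝ] ℝ} (hΛ : ∀ f, (∀ x, 0 ≤ f x) → 0 ≤ Λ f)
    (hΛ1 : Λ 1 = 1) (hΛ0 : ∀ f ∈ leviFunctions N, Λ f = 0) :
    IsLeviCurrent g ρ (Current11.ofFunctional N (complexify Λ)) := by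
  have hzero : ∀ φ : TestForm11 E M, (∀ p ∈ N, diag (φ : Form11 E M) p = 0) →
      (Current11.ofFunctional N (complexify Λ)).toFun φ = 0 := fun φ h => by
    have : restrictDiag N φ = 0 := ContinuousMap.ext fun p => h p p.2
    change complexify Λ (restrictDiag N φ) = 0
    rw [this, map_zero]
  constructor
  · intro φ hφ
    change 0 ≤ complexify Λ (restrictDiag N φ)
    have h1 : Complex.imCLM.compLeftContinuous ℝ N (restrictDiag N φ) = 0 :=
      ContinuousMap.ext fun p => (Complex.le_def.1 (hφ p.1.1 p.1.2)).2.symm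
    have h2 : 0 ≤ Λ (Complex.reCLM.compLeftContinuous ℝ N (restrictDiag N φ)) :=
      hΛ _ fun p => (Complex.le_def.1 (hφ p.1.1 p.1.2)).1
    change 0 ≤ (Λ (Complex.reCLM.compLeftContinuous ℝ N (restrictDiag N φ)) : ℂ) +
      Complex.I * (Λ (Complex.imCLM.compLeftContinuous ℝ N (restrictDiag N φ)) : ℂ)
    rw [h1, map_zero, Complex.ofReal_zero, mul_zero, add_zero]
    exact Complex.zero_le_real.2 h2
  · intro φ hφ
    refine hzero φ fun p hp => ?_
    have h : (φ : Form11 E M) p.1 = 0 := by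
      by_contra hne
      exact disjoint_left.1 hφ (subset_closure hne) (hN hp).1.1
    rw [diag, h]
    rfl
  · intro β hβ
    refine hzero _ fun p hp => ?_
    have h : del E ρ.rC p.1 p.2 = 0 := by
      have h1 := ρ.diag_ddbar_sq (hN hp).1.1
      rw [(hN hp).2.1] at h1
      exact Complex.normSq_eq_zero.1 (by linarith)
    change del E ρ.rC p.1 p.2 • β p.1 p.2 = 0
    rw [h, zero_smul]
  · intro χ hχ
    refine hzero _ fun p hp => ?_
    have h : diag (ddbar E ρ.rC) p = 0 :=
      Complex.ext (hN hp).2.2 (ddbar_ofReal_self_im ρ.isOpen_nhd ρ.smooth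
        (ρ.closure_subset (frontier_subset_closure (hN hp).1.1)) p.2)
    change χ p.1 * diag (ddbar E ρ.rC) p = 0
    rw [h, mul_zero]
  · intro u hu
    have h1 : Λ (Complex.reCLM.compLeftContinuous ℝ N (restrictDiag N (ddbarTest u hu))) = 0 :=
      hΛ0 _ ⟨_, hu.re, fun p => (diag_ddbar_eq hu p).1⟩
    have h2 : Λ (Complex.imCLM.compLeftContinuous ℝ N (restrictDiag N (ddbarTest u hu))) = 0 :=
      hΛ0 _ ⟨_, hu.im, fun p => (diag_ddbar_eq hu p).2⟩
    change (Λ (Complex.reCLM.compLeftContinuous ℝ N (restrictDiag N (ddbarTest u hu))) : ℂ) +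
      Complex.I *
        (Λ (Complex.imCLM.compLeftContinuous ℝ N (restrictDiag N (ddbarTest u hu))) : ℂ) = 0
    rw [h1, h2, Complex.ofReal_zero, mul_zero, add_zero]
  · intro χ hχ hχ1
    have h : ∀ p : N, restrictDiag N (cutoff isOpen_univ g.form g.smooth χ hχ) p = 1 := fun p => by
      change χ p.1.1 * diag g.form p.1 = 1
      rw [hχ1.self_of_nhdsSet _ (hN p.2).1.1, (hN p.2).1.2, mul_one]
    have h1 : Complex.reCLM.compLeftContinuous ℝ N
        (restrictDiag N (cutoff isOpen_univ g.form g.smooth χ hχ)) = 1 :=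
      ContinuousMap.ext fun p => (congrArg Complex.re (h p)).trans Complex.one_re
    have h2 : Complex.imCLM.compLeftContinuous ℝ N
        (restrictDiag N (cutoff isOpen_univ g.form g.smooth χ hχ)) = 0 :=
      ContinuousMap.ext fun p => (congrArg Complex.im (h p)).trans Complex.one_im
    change (Λ (Complex.reCLM.compLeftContinuous ℝ N (restrictDiag N _)) : ℂ) +
      Complex.I * (Λ (Complex.imCLM.compLeftContinuous ℝ N (restrictDiag N _)) : ℂ) = 1
    rw [h1, h2, hΛ1, map_zero, Complex.ofReal_zero, mul_zero, add_zero, Complex.ofReal_one]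

/-- If the Levi form of `u` is positive on the null vectors of a pseudoconvex boundary, then
`u + A r + B r²` is strictly plurisubharmonic near the boundary for suitable `A` and `B`. -/
theorem DefiningFunction.exists_strictlyPsh [T2Space M] (g : HermitianMetric E M) {U : Set M}
    (hK : IsCompact (frontier U)) (ρ : DefiningFunction E U) (hρ : ρ.IsPseudoconvex) {u : M → ℝ}
    (hu : ContMDiffOn 𝓘(ℝ, E) 𝓘(ℝ, ℝ) ∞ u univ)
    (hpos : ∀ p ∈ ρ.nullVectors g, 0 < (diag (ddbar E fun x => (u x : ℂ)) p).re) :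
    ∃ (V : Set M) (w : M → ℝ), IsOpen V ∧ frontier U ⊆ V ∧ IsSmoothStrictlyPshOn E w V := by
  set S := g.sphere (frontier U) with hS
  set a := fun p => (diag (ddbar E fun x => (u x : ℂ)) p).re with ha
  set l := fun p => (diag (ddbar E fun x => (ρ.r x : ℂ)) p).re with hl
  set q := fun p => (diag (ddbar E fun x => ((ρ.r x ^ 2 : ℝ) : ℂ)) p).re with hq
  have hKn : frontier U ⊆ ρ.nhd := frontier_subset_closure.trans ρ.closure_subset
  have hSn : S ⊆ {p | p.1 ∈ ρ.nhd} := fun p hp => hKn hp.1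
  have hSc : IsClosed S := g.isClosed_sphere isClosed_frontier
  have hScp : IsCompact S := g.isCompact_sphere hK
  have hun := hu.mono (subset_univ ρ.nhd)
  have hac : ContinuousOn a S := (continuousOn_diag_ddbar ρ.isOpen_nhd hun).mono hSn
  have hlc : ContinuousOn l S := (continuousOn_diag_ddbar ρ.isOpen_nhd ρ.smooth).mono hSn
  have hqc : ContinuousOn q S := (continuousOn_diag_ddbar ρ.isOpen_nhd ρ.smooth_sq).mono hSn
  have hZ : IsClosed (S ∩ q ⁻¹' {0}) := hqc.preimage_isClosed_of_isClosed hSc isClosed_singleton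
  -- `A` takes care of the complex tangent vectors, and `B` of the remaining directions.
  obtain ⟨A, hA⟩ := exists_pos_add_mul (hScp.of_isClosed_subset hZ inter_subset_left) hZ
    (hac.mono inter_subset_left) (hlc.mono inter_subset_left) (fun p hp => by
      have h1 := ρ.diag_ddbar_sq hp.1.1
      have h2 : q p = 0 := hp.2
      refine (Complex.le_def.1 (hρ p.1 hp.1.1 p.2 (Complex.normSq_eq_zero.1 ?_))).1
      simp only [hq] at h2
      linarith)
    fun p hp h0 => hpos p ⟨hp.1, hp.2, h0⟩
  obtain ⟨B, hB⟩ := exists_pos_add_mul hScp hSc (hac.add (hlc.const_smul A)) hqc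
    (fun p hp => by
      exact (mul_nonneg zero_le_two (Complex.normSq_nonneg _)).trans_eq
        (ρ.diag_ddbar_sq hp.1).symm)
    fun p hp h0 => hA p ⟨hp, h0⟩
  have hr := contMDiffOn_ofReal ρ.smooth
  have hr2 := contMDiffOn_ofReal ρ.smooth_sq
  have hAr : ContMDiffOn 𝓘(ℝ, E) 𝓘(ℝ, ℝ) ∞ (fun x => A * ρ.r x) ρ.nhd :=
    contMDiffOn_const.mul ρ.smooth
  have hBr : ContMDiffOn 𝓘(ℝ, E) 𝓘(ℝ, ℝ) ∞ (fun x => B * ρ.r x ^ 2) ρ.nhd :=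
    contMDiffOn_const.mul ρ.smooth_sq
  obtain ⟨V, hV, hKV, hw⟩ := exists_isSmoothStrictlyPshOn g ρ.isOpen_nhd
    ((hun.add hAr).add hBr) hK hKn fun p hp => by
      have hpn := hSn hp
      have h1 : ddbar E (fun x => (A : ℂ) * (ρ.r x : ℂ)) p.1 = _ :=
        ddbar_const_mul ρ.isOpen_nhd hr hpn A
      have h2 : ddbar E (fun x => (B : ℂ) * ((ρ.r x ^ 2 : ℝ) : ℂ)) p.1 = _ :=
        ddbar_const_mul ρ.isOpen_nhd hr2 hpn B
      have hAr' := contMDiffOn_ofReal hAr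
      have hBr' := contMDiffOn_ofReal hBr
      simp only [Complex.ofReal_mul] at hAr' hBr'
      have h3 := ddbar_add ρ.isOpen_nhd (contMDiffOn_ofReal hun) hAr' hpn
      have h4 := ddbar_add ρ.isOpen_nhd ((contMDiffOn_ofReal hun).add hAr') hBr' hpn
      have h5 : (fun x => (((u + fun x => A * ρ.r x) + fun x => B * ρ.r x ^ 2 : M → ℝ) x : ℂ)) =
          ((fun x => (u x : ℂ)) + fun x => (A : ℂ) * (ρ.r x : ℂ)) +
            fun x => (B : ℂ) * ((ρ.r x ^ 2 : ℝ) : ℂ) := by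
        ext x
        simp
      have h6 := hB p hp
      rw [h5, diag, h4, h3, h1, h2]
      change 0 < (diag (ddbar E fun x => (u x : ℂ)) p +
        (A : ℂ) * diag (ddbar E fun x => (ρ.r x : ℂ)) p +
        (B : ℂ) * diag (ddbar E fun x => ((ρ.r x ^ 2 : ℝ) : ℂ)) p).re
      rw [Complex.add_re, Complex.add_re, Complex.re_ofReal_mul, Complex.re_ofReal_mul]
      exact h6
  exact ⟨V, _, hV, hKV, hw⟩

end NullVectors

end LeviCurrent

end

theorem proposition2p1 {E : Type*} [NormedAddCommGroup E] [NormedSpace ℂ E]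
    [FiniteDimensional ℂ E] {M : Type*} [TopologicalSpace M] [T2Space M]
    [SecondCountableTopology M] [ChartedSpace E M] [IsManifold 𝓘(ℂ, E) ω M]
    (g : LeviCurrent.HermitianMetric E M) (U : Set M) (hU : IsCompact (closure U))
    (ρ : LeviCurrent.DefiningFunction E U) (hρ : ρ.IsPseudoconvex) :
    (¬ ∃ T : LeviCurrent.Current11 E M, LeviCurrent.IsLeviCurrent g ρ T) ↔
      ∃ (V : Set M) (u : M → ℝ), IsOpen V ∧ frontier U ⊆ V ∧
        LeviCurrent.IsSmoothStrictlyPshOn E u V := by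
  refine ⟨fun hno => ?_, fun ⟨V, u, hV, hUV, hu⟩ ⟨T, hT⟩ =>
    LeviCurrent.not_isLeviCurrent_of_strictlyPsh g hU ρ hV hUV hu T hT⟩
  have hK : IsCompact (frontier U) :=
    hU.of_isClosed_subset isClosed_frontier frontier_subset_closure
  have : CompactSpace (ρ.nullVectors g) :=
    isCompact_iff_compactSpace.1 (ρ.isCompact_nullVectors g hK)
  obtain ⟨f, ⟨u, hu, hfu⟩, hpos⟩ : ∃ f ∈ LeviCurrent.leviFunctions (ρ.nullVectors g),
      ∀ p, 0 < f p := by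
    by_contra! h
    obtain ⟨Λ, h1, h2, h3⟩ := LeviCurrent.exists_positive_functional
      (LeviCurrent.leviFunctions (ρ.nullVectors g)) fun f hf hfp => by
        obtain ⟨p, hp⟩ := h f hf
        exact hp.not_gt (hfp p)
    exact hno ⟨_, ρ.isLeviCurrent_ofFunctional g subset_rfl h1 h2 h3⟩
  refine ρ.exists_strictlyPsh g hK hρ hu.contMDiffOn_real fun p hp => ?_
  rw [← hfu ⟨p, hp⟩, Complex.ofReal_re]
  exact hpos ⟨p, hp⟩
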